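/- **Setting.** An instance of the summer internship problem (SIP) consists of finite sets $A$ (applicants), $P$ (projects) and $S$ (supervisors). Each applicant strictly ranks the projects acceptable to it, and each project ranks the applicants acceptable to it. Each project $p$ has a capacity $c_p\in\mathbb{N}$. Each supervisor $s$ has a set $P_s\subseteq P$ of supervised projects and a real, infinitely divisible budget $q_s\ge 0$; write $S_p=\{s\in S: p\in P_s\}$. A *matching* is a set $M\subseteq A\times P$ such that each applicant occurs in at most one pair, each project $p$ occurs in at most $c_p$ pairs, and in each pair both members find each other acceptable. Let $M(p)$ be the set of applicants matched to $p$. The matching $M$ is *feasible* if there are reals $x_{s,p}\ge 0$ ($s\in S$, $p\in P_s$) with $\sum_{s\in S_p}x_{s,p}=|M(p)|$ for all $p\in P$ and $\sum_{p\in P_s}x_{s,p}\le q_s$ for all $s\in S$. The *funding flow network* $G_M$ has vertex set $\{s^*\}\cup S\cup P\cup\{t^*\}$, source $s^*$, sink $t^*$, and arcs $(s^*,s)$ of capacity $q_s$ for $s\in S$, arcs $(s,p)$ of capacity $\infty$ for $s\in S$, $p\in P_s$, and arcs $(p,t^*)$ of capacity $|M(p)|$ for $p\in P$. **Theorem.**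 1. A matching $M$ of an SIP instance is feasible if and only if $G_M$ admits a feasible $s^*$-$t^*$ flow of value $|M|$. 2. Feasibility of a matching can be checked in time $O(\max\{|S|,|P|\}^3)$: there is a single program which, for every SIP instance and every matching $M$ of it, halts within $T(\max\{|S|,|P|\})$ steps, where $T(n)=O(n^3)$, and outputs $1$ if $M$ is feasible and $0$ otherwise. In part 2 time is counted on a random access machine with unit-cost operations, with registers and two-dimensional arrays for indices (natural numbers, which can be reset to $0$, copied, incremented, decremented, compared and used to address array cells) and for exact real numbers (which can be reset to $0$, copied, added, subtracted and compared). The input consists of $|S|$, $|P|$, the $0$-$1$ incidence matrix of the relation $p\in P_s$, the budgets $q_s$, and the numbers $|M(p)|$, for arbitrary numberings of $S$ and $P$. -/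

import Mathlib

/-! ### The summer internship problem -/

/-- An instance of the summer internship problem with applicants `A`, projects `P` and
supervisors `S`. Preferences are lists, most preferred first, of the acceptable partners. -/
structure SIP (A P S : Type*) where
  applicantPref : A → List P
  applicantPref_nodup : ∀ a, (applicantPref a).Nodup
  projectPref : P → List A
  projectPref_nodup : ∀ p, (projectPref p).Nodup
  /-- the maximum capacity `c_p` -/
  capacity : P → ℕ
  /-- the projects `P_s` that the supervisor `s` supervises -/
  supervised : S → Finset P
  /-- the budget `q_s`, which is infinitely divisible -/
  budget : S → ℝ
  budget_nonneg : ∀ s, 0 ≤ budget s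

/-- The number `|M(p)|` of applicants that `M` matches to the project `p`. -/
def matchedCount {A P : Type*} [DecidableEq P] (M : Finset (A × P)) (p : P) : ℕ :=
  (M.filter (fun e => e.2 = p)).card

namespace SIP

/-- Matchings of an instance. -/
structure IsMatching {A P S : Type*} [DecidableEq A] [DecidableEq P]
    (I : SIP A P S) (M : Finset (A × P)) : Prop where
  applicant_le_one : ∀ a, (M.filter (fun e => e.1 = a)).card ≤ 1
  acceptable_to_applicant : ∀ e ∈ M, e.2 ∈ I.applicantPref e.1
  le_capacity : ∀ p, matchedCount M p ≤ I.capacity p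
  acceptable_to_project : ∀ e ∈ M, e.1 ∈ I.projectPref e.2

/-- `x` is a feasible funding allocation for `M`. Only the values `x s p` with `p ∈ P_s`
matter. -/
structure IsFundingAllocation {A P S : Type*} [DecidableEq P] [Fintype S]
    (I : SIP A P S) (M : Finset (A × P)) (x : S → P → ℝ) : Prop where
  nonneg : ∀ s, ∀ p ∈ I.supervised s, 0 ≤ x s p
  funded : ∀ p, ∑ s ∈ Finset.univ.filter (fun s => p ∈ I.supervised s), x s p
    = (matchedCount M p : ℝ)
  within_budget : ∀ s, ∑ p ∈ I.supervised s, x s p ≤ I.budget s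

/-- `M` is (supervisor-)feasible. -/
def Feasible {A P S : Type*} [DecidableEq P] [Fintype S]
    (I : SIP A P S) (M : Finset (A × P)) : Prop :=
  ∃ x : S → P → ℝ, I.IsFundingAllocation M x

end SIP

/-! ### Flow networks -/

/-- A directed network with a source, a sink and possibly infinite capacities; the values of
`cap` off the arcs are irrelevant. -/
structure FlowNetwork (V : Type*) where
  Arc : V → V → Prop
  cap : V → V → EReal
  source : V
  sink : V

/-- Feasible source-sink flows. -/
structure FlowNetwork.IsFlow {V : Type*} [Fintype V] (N : FlowNetwork V) (f : V → V → ℝ) :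
    Prop where
  nonneg : ∀ u v, 0 ≤ f u v
  off_arcs : ∀ u v, ¬ N.Arc u v → f u v = 0
  le_cap : ∀ u v, N.Arc u v → (f u v : EReal) ≤ N.cap u v
  conservation : ∀ v, v ≠ N.source → v ≠ N.sink → ∑ u, f u v = ∑ w, f v w

/-- The value of a flow: the net amount that leaves the source. -/
def FlowNetwork.value {V : Type*} [Fintype V] (N : FlowNetwork V) (f : V → V → ℝ) : ℝ :=
  ∑ v, f N.source v - ∑ v, f v N.source

/-- The vertices `{s*} ∪ S ∪ P ∪ {t*}` of the funding flow graph. -/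
inductive FundingVertex (P S : Type*) where
  | source : FundingVertex P S
  | supervisor : S → FundingVertex P S
  | project : P → FundingVertex P S
  | sink : FundingVertex P S

def FundingVertex.equivSum (P S : Type*) : (Bool ⊕ (S ⊕ P)) ≃ FundingVertex P S where
  toFun
    | .inl true => .source
    | .inl false => .sink
    | .inr (.inl s) => .supervisor s
    | .inr (.inr p) => .project p
  invFun
    | .source => .inl true
    | .sink => .inl false
    | .supervisor s => .inr (.inl s)
    | .project p => .inr (.inr p)
  left_inv := by rintro ((_ | _) | (_ | _)) <;> rfl
  right_inv := by rintro (_ | _ | _ | _) <;> rfl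

instance FundingVertex.instFintype (P S : Type*) [Fintype P] [Fintype S] :
    Fintype (FundingVertex P S) :=
  Fintype.ofEquiv _ (FundingVertex.equivSum P S)

/-- The funding flow graph `G_M` of a matching `M`. -/
noncomputable def SIP.fundingNetwork {A P S : Type*} [DecidableEq P] (I : SIP A P S) (M : Finset (A × P)) :
    FlowNetwork (FundingVertex P S) where
  Arc
    | .source, .supervisor _ => True
    | .supervisor s, .project p => p ∈ I.supervised s
    | .project _, .sink => True
    | _, _ => False
  cap
    | .source, .supervisor s => ((I.budget s : ℝ) : EReal)
    | .supervisor _, .project _ => ⊤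
    | .project p, .sink => ((matchedCount M p : ℝ) : EReal)
    | _, _ => 0
  source := .source
  sink := .sink

/-! ### The machine model

Programs for a random access machine in which every operation takes one unit of time. There
are registers and two-dimensional arrays (the cells being addressed by registers) for indices,
which are natural numbers, and for numbers, which are exact reals. Indices can only be reset,
copied, incremented, decremented and compared, so that within `t` steps no index exceeds its
largest initial value by more than `t`; numbers can only be copied, added, subtracted and
compared. There is no conversion between the two kinds. -/

/-- The contents of the memory: index registers, number registers, index arrays and number
arrays. `idxArr k i j` is the cell `(i, j)` of the `k`-th index array. -/
structure Memory where
  idx : ℕ → ℕ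
  num : ℕ → ℝ
  idxArr : ℕ → ℕ → ℕ → ℕ
  numArr : ℕ → ℕ → ℕ → ℝ

/-- The elementary operations. The arguments are (fixed) names of registers and arrays. -/
inductive Instr where
  /-- index register `x := 0` -/
  | idxZero (x : ℕ) : Instr
  /-- index registers `x := y` -/
  | idxCopy (x y : ℕ) : Instr
  /-- index registers `x := y + 1` -/
  | idxSucc (x y : ℕ) : Instr
  /-- index registers `x := y - 1`, truncated at zero -/
  | idxPred (x y : ℕ) : Instr
  /-- `x := a[i, j]`, where the registers `i` and `j` hold the position -/
  | idxLoad (x a i j : ℕ) : Instr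
  /-- `a[i, j] := x` -/
  | idxStore (a i j x : ℕ) : Instr
  /-- number register `u := 0` -/
  | numZero (u : ℕ) : Instr
  /-- number registers `u := v` -/
  | numCopy (u v : ℕ) : Instr
  /-- number registers `u := v + w` -/
  | numAdd (u v w : ℕ) : Instr
  /-- number registers `u := v - w` -/
  | numSub (u v w : ℕ) : Instr
  /-- `u := b[i, j]`, where the index registers `i` and `j` hold the position -/
  | numLoad (u b i j : ℕ) : Instr
  /-- `b[i, j] := u` -/
  | numStore (b i j u : ℕ) : Instr

/-- Overwriting one cell of one of the arrays. -/
def setCell {α : Type*} (arr : ℕ → ℕ → ℕ → α) (k i j : ℕ) (z : α) : ℕ → ℕ → ℕ → α :=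
  fun k' i' j' => if k' = k ∧ i' = i ∧ j' = j then z else arr k' i' j'

/-- The effect of an elementary operation on the memory. -/
noncomputable def Instr.apply : Instr → Memory → Memory
  | .idxZero x, m => { m with idx := Function.update m.idx x 0 }
  | .idxCopy x y, m => { m with idx := Function.update m.idx x (m.idx y) }
  | .idxSucc x y, m => { m with idx := Function.update m.idx x (m.idx y + 1) }
  | .idxPred x y, m => { m with idx := Function.update m.idx x (m.idx y - 1) }
  | .idxLoad x a i j, m =>
      { m with idx := Function.update m.idx x (m.idxArr a (m.idx i) (m.idx j)) }
  | .idxStore a i j x, m =>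
      { m with idxArr := setCell m.idxArr a (m.idx i) (m.idx j) (m.idx x) }
  | .numZero u, m => { m with num := Function.update m.num u 0 }
  | .numCopy u v, m => { m with num := Function.update m.num u (m.num v) }
  | .numAdd u v w, m => { m with num := Function.update m.num u (m.num v + m.num w) }
  | .numSub u v w, m => { m with num := Function.update m.num u (m.num v - m.num w) }
  | .numLoad u b i j, m =>
      { m with num := Function.update m.num u (m.numArr b (m.idx i) (m.idx j)) }
  | .numStore b i j u, m =>
      { m with numArr := setCell m.numArr b (m.idx i) (m.idx j) (m.num u) }

/-- Comparisons between two registers of the same kind. -/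
inductive Comparison where
  | idxLt (x y : ℕ) : Comparison
  | idxLe (x y : ℕ) : Comparison
  | numLt (u v : ℕ) : Comparison
  | numLe (u v : ℕ) : Comparison

def Comparison.Holds : Comparison → Memory → Prop
  | .idxLt x y, m => m.idx x < m.idx y
  | .idxLe x y, m => m.idx x ≤ m.idx y
  | .numLt u v, m => m.num u < m.num v
  | .numLe u v, m => m.num u ≤ m.num v

/-- Programs: elementary operations, the empty program, sequencing, `if b then c else d` and
`while b do c`. -/
inductive Program where
  | instr (i : Instr) : Program
  | skip : Program
  | seq (c d : Program) : Program
  | branch (b : Comparison) (c d : Program) : Program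
  | loop (b : Comparison) (c : Program) : Program

/-- `Exec c m t m'`: started on the memory `m`, the program `c` halts after exactly `t` steps
with the memory `m'`. Each elementary operation and each comparison takes one step. -/
inductive Exec : Program → Memory → ℕ → Memory → Prop where
  | instr (i : Instr) (m : Memory) : Exec (.instr i) m 1 (i.apply m)
  | skip (m : Memory) : Exec .skip m 1 m
  | seq {c d : Program} {m₀ m₁ m₂ : Memory} {t₁ t₂ : ℕ} :
      Exec c m₀ t₁ m₁ → Exec d m₁ t₂ m₂ → Exec (.seq c d) m₀ (t₁ + t₂) m₂
  | branch_true {b : Comparison} {c d : Program} {m₀ m₁ : Memory} {t : ℕ} :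
      b.Holds m₀ → Exec c m₀ t m₁ → Exec (.branch b c d) m₀ (t + 1) m₁
  | branch_false {b : Comparison} {c d : Program} {m₀ m₁ : Memory} {t : ℕ} :
      ¬ b.Holds m₀ → Exec d m₀ t m₁ → Exec (.branch b c d) m₀ (t + 1) m₁
  | loop_true {b : Comparison} {c : Program} {m₀ m₁ m₂ : Memory} {t₁ t₂ : ℕ} :
      b.Holds m₀ → Exec c m₀ t₁ m₁ → Exec (.loop b c) m₁ t₂ m₂ →
        Exec (.loop b c) m₀ (t₁ + t₂ + 1) m₂
  | loop_false {b : Comparison} {c : Program} {m : Memory} :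
      ¬ b.Holds m → Exec (.loop b c) m 1 m

/-- The input memory for an instance and a matching, where `eS` and `eP` number the supervisors
and the projects. Index registers 0 and 1 hold `|S|` and `|P|`, index array 0 is the 0-1 matrix
of the relation `p ∈ P_s`, column 0 of number array 0 holds the budgets, and column 0 of number
array 1 holds the sizes `|M(p)|`. Everything else is zero. -/
noncomputable def SIP.inputMemory {A P S : Type*} [DecidableEq P] [Fintype P] [Fintype S]
    (I : SIP A P S) (M : Finset (A × P))
    (eS : S ≃ Fin (Fintype.card S)) (eP : P ≃ Fin (Fintype.card P)) : Memory where
  idx x := if x = 0 then Fintype.card S else if x = 1 then Fintype.card P else 0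
  num _ := 0
  idxArr k i j :=
    if h : k = 0 ∧ i < Fintype.card S ∧ j < Fintype.card P then
      if eP.symm ⟨j, h.2.2⟩ ∈ I.supervised (eS.symm ⟨i, h.2.1⟩) then 1 else 0
    else 0
  numArr k i j :=
    if h : k = 0 ∧ j = 0 ∧ i < Fintype.card S then I.budget (eS.symm ⟨i, h.2.2⟩)
    else if h : k = 1 ∧ j = 0 ∧ i < Fintype.card P then
      (matchedCount M (eP.symm ⟨i, h.2.2⟩) : ℝ)
    else 0

/-!
A flow of value `|M|` saturates all arcs into the sink, because their capacities add up to `|M|`;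
so feasible allocations and flows of value `|M|` are the same thing
(`SIP.feasible_iff_exists_isFlow`).

The program decides whether the demands `|M(p)|` can be routed from the projects through the
supervisors to a sink. It is a push-relabel algorithm on the dense residual network with
`N = |S| + |P| + 1` vertices, which starts with all demand as excess at the projects and with all
labels zero. The vertices are scanned in passes; each vertex in turn pushes its excess along its
current arc to a vertex with a smaller label, goes on to its next arc when the current one is of no
use, and is relabelled, with an increment by one, when all arcs have been tried. The algorithm stops
after a pass in which nothing has happened, where no excess is left and the flow found is an
allocation, or when a label reaches `N`. In this case some label between `1` and `N - 1` is not in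
use, and since residual arcs descend by at most one label, the vertices above it are cut off from
the sink with a positive excess (`not_routable_of_label`).

There are at most `N ^ 2` relabellings, so at most `N ^ 3` moves of current arcs. In a pass without a
relabelling all excess moves down, so the largest label of an active vertex drops; since it rises
only by relabellings, there are `O(N ^ 2)` passes. Hence `PushState.potential`, which is `O(N ^ 3)`,
bounds the number of steps: each step keeps the invariant `PushState.Inv` and lowers the potential,
or stops with the right answer (`PushState.Inv.step`). One step is a program without loops
(`halts_stepProgram`), so the loop rule with amortized costs `Halts.loop` turns the potential into a
bound for the running time.
-/

/-! ### Feasible matchings and flows of the funding network -/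

namespace FundingVertex

theorem sum_eq {P S : Type*} [Fintype P] [Fintype S] (g : FundingVertex P S → ℝ) :
    ∑ v, g v = g .source + g .sink + ∑ s, g (.supervisor s) + ∑ p, g (.project p) := by
  rw [← Equiv.sum_comp (equivSum P S) g, Fintype.sum_sum_type, Fintype.sum_sum_type,
    Fintype.sum_bool, ← add_assoc]
  rfl

end FundingVertex

theorem sum_matchedCount {A P : Type*} [Fintype P] [DecidableEq P] (M : Finset (A × P)) :
    ∑ p, (matchedCount M p : ℝ) = M.card := by
  rw [Finset.card_eq_sum_card_fiberwise (f := Prod.snd) (t := Finset.univ) (by simp)]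
  simp [matchedCount]

namespace SIP

variable {A P S : Type*} [Fintype P] [Fintype S] [DecidableEq P]

/-- The flow that a funding allocation induces: each supervisor receives what it spends, and
each project passes on what it receives. -/
noncomputable def allocationFlow (I : SIP A P S) (M : Finset (A × P)) (x : S → P → ℝ) :
    FundingVertex P S → FundingVertex P S → ℝ
  | .source, .supervisor s => ∑ p ∈ I.supervised s, x s p
  | .supervisor s, .project p => if p ∈ I.supervised s then x s p else 0
  | .project p, .sink => matchedCount M p
  | _, _ => 0

theorem IsFundingAllocation.isFlow {I : SIP A P S} {M : Finset (A × P)} {x : S → P → ℝ}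
    (hx : I.IsFundingAllocation M x) :
    (I.fundingNetwork M).IsFlow (I.allocationFlow M x) where
  nonneg u v := by
    rcases u with _ | s | p | _ <;> rcases v with _ | s' | p' | _ <;>
      simp only [allocationFlow, le_refl, Nat.cast_nonneg]
    · exact Finset.sum_nonneg (hx.nonneg _)
    · split_ifs with h
      · exact hx.nonneg _ _ h
      · exact le_rfl
  off_arcs u v h := by
    rcases u with _ | s | p | _ <;> rcases v with _ | s' | p' | _ <;>
      simp_all [allocationFlow, fundingNetwork]
  le_cap u v h := by
    rcases u with _ | s | p | _ <;> rcases v with _ | s' | p' | _ <;>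
      simp_all [allocationFlow, fundingNetwork, hx.within_budget]
  conservation v h₁ h₂ := by
    rcases v with _ | s | p | _
    · simp [fundingNetwork] at h₁
    · simp [FundingVertex.sum_eq, allocationFlow, Finset.sum_ite_mem]
    · simp [FundingVertex.sum_eq, allocationFlow, ← hx.funded p, Finset.sum_filter]
    · simp [fundingNetwork] at h₂

theorem IsFundingAllocation.value_allocationFlow {I : SIP A P S} {M : Finset (A × P)}
    {x : S → P → ℝ} (hx : I.IsFundingAllocation M x) :
    (I.fundingNetwork M).value (I.allocationFlow M x) = M.card := by
  simp only [FlowNetwork.value, FundingVertex.sum_eq, fundingNetwork, allocationFlow,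
    ← sum_matchedCount M, ← hx.funded, Finset.sum_filter]
  rw [Finset.sum_comm]
  simp [Finset.sum_ite_mem]

/-- A flow of value `|M|` must saturate every arc into the sink, because the capacities of these
arcs add up to `|M|`; so its values on the arcs between supervisors and projects fund `M`. -/
theorem isFundingAllocation_of_isFlow {I : SIP A P S} {M : Finset (A × P)}
    {f : FundingVertex P S → FundingVertex P S → ℝ} (hf : (I.fundingNetwork M).IsFlow f)
    (hv : (I.fundingNetwork M).value f = M.card) :
    I.IsFundingAllocation M (fun s p => f (.supervisor s) (.project p)) := by
  have z₁ : ∀ v, f v .source = 0 := fun v => hf.off_arcs _ _ (by cases v <;> exact id)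
  have z₂ : ∀ v, f .sink v = 0 := fun v => hf.off_arcs _ _ (by cases v <;> exact id)
  have z₃ : f .source .sink = 0 := hf.off_arcs _ _ id
  have z₄ : ∀ p, f .source (.project p) = 0 := fun _ => hf.off_arcs _ _ id
  have z₅ : ∀ s, f (.supervisor s) .sink = 0 := fun _ => hf.off_arcs _ _ id
  have z₆ : ∀ s s', f (.supervisor s) (.supervisor s') = 0 := fun _ _ => hf.off_arcs _ _ id
  have z₇ : ∀ p s, f (.project p) (.supervisor s) = 0 := fun _ _ => hf.off_arcs _ _ id
  have z₈ : ∀ p p', f (.project p) (.project p') = 0 := fun _ _ => hf.off_arcs _ _ id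
  have hin : ∀ p, ∑ s, f (.supervisor s) (.project p) = f (.project p) .sink := by
    intro p
    have h := hf.conservation (.project p) (by simp [fundingNetwork]) (by simp [fundingNetwork])
    simpa [FundingVertex.sum_eq, z₁, z₂, z₄, z₇, z₈] using h
  have hout : ∀ s, ∑ p, f (.supervisor s) (.project p) = f .source (.supervisor s) := by
    intro s
    have h := hf.conservation (.supervisor s) (by simp [fundingNetwork])
      (by simp [fundingNetwork])
    simpa [FundingVertex.sum_eq, z₁, z₂, z₅, z₆, z₇] using h.symm
  have hle : ∀ p, f (.project p) .sink ≤ matchedCount M p := by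
    intro p
    have h := hf.le_cap (.project p) .sink (by simp [fundingNetwork])
    exact EReal.coe_le_coe_iff.1 h
  have hval : ∑ s, f .source (.supervisor s) = ∑ p, (matchedCount M p : ℝ) := by
    rw [sum_matchedCount, ← hv]
    simp [FlowNetwork.value, FundingVertex.sum_eq, fundingNetwork, z₁, z₃, z₄]
  have hsum : ∑ p, f (.project p) .sink = ∑ p, (matchedCount M p : ℝ) := by
    simp_rw [← hval, ← hout, ← hin]
    exact Finset.sum_comm
  have heq := (Finset.sum_eq_sum_iff_of_le (fun p _ => hle p)).1 hsum
  refine ⟨fun s p _ => hf.nonneg _ _, fun p => ?_, fun s => ?_⟩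
  · rw [← heq p (Finset.mem_univ p), ← hin p, Finset.sum_filter]
    refine Finset.sum_congr rfl fun s _ => ?_
    split_ifs with h
    · rfl
    · exact (hf.off_arcs (.supervisor s) (.project p) h).symm
  · have h := hf.le_cap .source (.supervisor s) (by simp [fundingNetwork])
    have h' : f .source (.supervisor s) ≤ I.budget s := EReal.coe_le_coe_iff.1 h
    rw [← hout s] at h'
    refine le_trans (Finset.sum_le_sum_of_subset_of_nonneg (Finset.subset_univ _) ?_) h'
    exact fun p _ _ => hf.nonneg _ _

theorem feasible_iff_exists_isFlow (I : SIP A P S) (M : Finset (A × P)) :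
    I.Feasible M ↔ ∃ f : FundingVertex P S → FundingVertex P S → ℝ,
      (I.fundingNetwork M).IsFlow f ∧ (I.fundingNetwork M).value f = (M.card : ℝ) :=
  ⟨fun ⟨_, hx⟩ => ⟨_, hx.isFlow, hx.value_allocationFlow⟩,
    fun ⟨_, hf, hv⟩ => ⟨_, isFundingAllocation_of_isFlow hf hv⟩⟩

end SIP

/-! ### Routing excesses to the sink -/

/-- In the residual network with vertices `0, …, N - 1` and residual capacities `r`, the excesses
`e` can be routed to the sink `0`. The routing is given by the residual capacities `r'` that it
leaves: `r v w - r' v w` is the net flow from `v` to `w`. -/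
def Routable (N : ℕ) (r : ℕ → ℕ → ℝ) (e : ℕ → ℝ) : Prop :=
  ∃ r' : ℕ → ℕ → ℝ, (∀ u < N, ∀ w < N, 0 ≤ r' u w) ∧
    (∀ u < N, ∀ w < N, r' u w + r' w u = r u w + r w u) ∧
    ∀ v < N, 0 < v → ∑ w ∈ Finset.range N, (r v w - r' v w) = e v

theorem routable_of_excess_eq_zero {N : ℕ} {r : ℕ → ℕ → ℝ} {e : ℕ → ℝ}
    (hr : ∀ u < N, ∀ w < N, 0 ≤ r u w) (he : ∀ v < N, 0 < v → e v = 0) : Routable N r e :=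
  ⟨r, hr, fun _ _ _ _ => rfl, fun v hv hv' => by simp [he v hv hv']⟩

/-- If no residual arc leaves the set `X` then the excess inside `X` cannot leave it. -/
theorem not_routable_of_cut {N : ℕ} {r : ℕ → ℕ → ℝ} {e : ℕ → ℝ} (X : Finset ℕ)
    (hX : ∀ v ∈ X, v < N ∧ 0 < v) (hcut : ∀ v ∈ X, ∀ w < N, w ∉ X → r v w ≤ 0)
    (he : 0 < ∑ v ∈ X, e v) : ¬ Routable N r e := by
  rintro ⟨r', hr', hs, hf⟩
  have hsub : X ⊆ Finset.range N := fun v hv => Finset.mem_range.2 (hX v hv).1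
  have h1 : ∑ v ∈ X, e v = ∑ v ∈ X, ∑ w ∈ Finset.range N, (r v w - r' v w) :=
    Finset.sum_congr rfl fun v hv => (hf v (hX v hv).1 (hX v hv).2).symm
  -- the net flow is antisymmetric, so that it cancels inside `X`
  have h2 : ∑ v ∈ X, ∑ w ∈ X, (r v w - r' v w) = 0 := by
    have h3 : ∑ v ∈ X, ∑ w ∈ X, (r v w - r' v w) = - ∑ v ∈ X, ∑ w ∈ X, (r v w - r' v w) := by
      conv_lhs => rw [Finset.sum_comm]
      simp_rw [← Finset.sum_neg_distrib]
      refine Finset.sum_congr rfl fun v hv => Finset.sum_congr rfl fun w hw => ?_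
      linarith [hs v (hX v hv).1 w (hX w hw).1]
    linarith
  have h4 : ∑ v ∈ X, ∑ w ∈ Finset.range N \ X, (r v w - r' v w) ≤ 0 := by
    refine Finset.sum_nonpos fun v hv => Finset.sum_nonpos fun w hw => ?_
    rw [Finset.mem_sdiff, Finset.mem_range] at hw
    linarith [hcut v hv w hw.1 hw.2, hr' v (hX v hv).1 w hw.1]
  have h5 : ∑ v ∈ X, e v = ∑ v ∈ X, ∑ w ∈ Finset.range N \ X, (r v w - r' v w)
      + ∑ v ∈ X, ∑ w ∈ X, (r v w - r' v w) := by
    rw [h1, ← Finset.sum_add_distrib]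
    exact Finset.sum_congr rfl fun v _ => (Finset.sum_sdiff hsub).symm
  linarith

/-- The gap argument: when a vertex with positive excess has reached the label `N`, some label
between `1` and `N - 1` is not in use, and no residual arc leads from above it to below it. -/
theorem not_routable_of_label {N : ℕ} {r : ℕ → ℕ → ℝ} {e : ℕ → ℝ} {d : ℕ → ℕ}
    (he : ∀ v < N, 0 ≤ e v) (hd : d 0 = 0)
    (hval : ∀ u < N, ∀ w < N, 0 < r u w → d u ≤ d w + 1)
    {v : ℕ} (hvN : v < N) (hv : 0 < v) (hdv : N ≤ d v) (hev : 0 < e v) : ¬ Routable N r e := by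
  have hgap : ∃ g, 1 ≤ g ∧ g < N ∧ ∀ u < N, d u ≠ g := by
    by_contra! hcon
    have hsub : Finset.Ico 1 N ⊆ (((Finset.range N).erase 0).erase v).image d := by
      intro g hg
      rw [Finset.mem_Ico] at hg
      obtain ⟨u, hu, rfl⟩ := hcon g hg.1 hg.2
      refine Finset.mem_image.2 ⟨u, ?_, rfl⟩
      simp only [Finset.mem_erase, Finset.mem_range]
      refine ⟨?_, ?_, hu⟩
      · rintro rfl; omega
      · rintro rfl; omega
    have h1 := (Finset.card_le_card hsub).trans Finset.card_image_le
    rw [Finset.card_erase_of_mem (by simp; omega), Finset.card_erase_of_mem (by simp; omega),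
      Finset.card_range, Nat.card_Ico] at h1
    omega
  obtain ⟨g, hg1, hgN, hg⟩ := hgap
  refine not_routable_of_cut ((Finset.range N).filter fun u => g < d u) ?_ ?_ ?_
  · intro u hu
    rw [Finset.mem_filter, Finset.mem_range] at hu
    refine ⟨hu.1, Nat.pos_of_ne_zero ?_⟩
    rintro rfl; omega
  · intro u hu w hw hwX
    simp only [Finset.mem_filter, Finset.mem_range] at hu hwX
    by_contra! hpos
    have h1 := hval u hu.1 w hw hpos
    have h2 := hg w hw
    have h3 : ¬ g < d w := fun h => hwX ⟨hw, h⟩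
    omega
  · refine Finset.sum_pos' (fun u hu => he u (Finset.mem_range.1 (Finset.mem_filter.1 hu).1))
      ⟨v, ?_, hev⟩
    simp only [Finset.mem_filter, Finset.mem_range]
    exact ⟨hvN, by omega⟩

theorem Routable.of_residual {N : ℕ} {r r₁ : ℕ → ℕ → ℝ} {e e₁ : ℕ → ℝ}
    (hs : ∀ u < N, ∀ w < N, r₁ u w + r₁ w u = r u w + r w u)
    (he : ∀ v < N, ∑ w ∈ Finset.range N, (r v w - r₁ v w) = e v - e₁ v)
    (h : Routable N r e) : Routable N r₁ e₁ := by
  obtain ⟨r', h1, h2, h3⟩ := h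
  refine ⟨r', h1, fun u hu w hw => by rw [h2 u hu w hw, hs u hu w hw], fun v hv hv' => ?_⟩
  have h4 := he v hv
  have h5 := h3 v hv hv'
  rw [Finset.sum_sub_distrib] at *
  linarith

/-- Replacing the residual capacities and the excesses by those that a flow leaves does not
change whether the excesses can be routed to the sink. -/
theorem routable_congr {N : ℕ} {r r₁ : ℕ → ℕ → ℝ} {e e₁ : ℕ → ℝ}
    (hs : ∀ u < N, ∀ w < N, r₁ u w + r₁ w u = r u w + r w u)
    (he : ∀ v < N, ∑ w ∈ Finset.range N, (r v w - r₁ v w) = e v - e₁ v) :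
    Routable N r₁ e₁ ↔ Routable N r e := by
  refine ⟨Routable.of_residual (fun u hu w hw => (hs u hu w hw).symm) fun v hv => ?_,
    Routable.of_residual hs he⟩
  have h4 := he v hv
  rw [Finset.sum_sub_distrib] at *
  linarith

/-- The residual capacities after pushing `δ` along the arc `(v, w)`. -/
noncomputable def pushRes (r : ℕ → ℕ → ℝ) (v w : ℕ) (δ : ℝ) : ℕ → ℕ → ℝ := fun a b =>
  if a = w ∧ b = v then r w v + δ else if a = v ∧ b = w then r v w - δ else r a b

/-- The excesses after pushing `δ` along the arc `(v, w)`. -/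
noncomputable def pushExc (e : ℕ → ℝ) (v w : ℕ) (δ : ℝ) : ℕ → ℝ := fun a =>
  if a = w then e w + δ else if a = v then e v - δ else e a

theorem routable_push {N : ℕ} {r : ℕ → ℕ → ℝ} {e : ℕ → ℝ} {v w : ℕ} (δ : ℝ)
    (hv : v < N) (hw : w < N) (hvw : v ≠ w) :
    Routable N (pushRes r v w δ) (pushExc e v w δ) ↔ Routable N r e := by
  refine routable_congr (fun a _ b _ => ?_) (fun a _ => ?_)
  · unfold pushRes
    by_cases h1 : a = w ∧ b = v
    · obtain ⟨rfl, rfl⟩ := h1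
      simp [hvw]
    · by_cases h2 : a = v ∧ b = w
      · obtain ⟨rfl, rfl⟩ := h2
        simp [hvw]
      · have h3 : ¬ (b = w ∧ a = v) := fun h => h2 ⟨h.2, h.1⟩
        have h4 : ¬ (b = v ∧ a = w) := fun h => h1 ⟨h.2, h.1⟩
        simp [h1, h2, h3, h4]
  · by_cases h1 : a = w
    · subst h1
      rw [Finset.sum_eq_single_of_mem v (Finset.mem_range.2 hv)]
      · simp [pushRes, pushExc]
      · intro b _ hb
        simp [pushRes, hb, hvw.symm]
    · by_cases h2 : a = v
      · subst h2
        rw [Finset.sum_eq_single_of_mem w (Finset.mem_range.2 hw)]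
        · simp [pushRes, pushExc, hvw]
        · intro b _ hb
          simp [pushRes, hb, hvw]
      · simp [pushRes, pushExc, h1, h2]

/-! ### The push-relabel algorithm -/

/-- The data of the push-relabel algorithm. The vertices are scanned in passes; `pos` is the
vertex that is scanned now, and `act` is nonzero if a push or a relabelling has taken place during
the current pass. `run` is zero once the algorithm has stopped with the answer `ans`. -/
structure PushState where
  res : ℕ → ℕ → ℝ
  exc : ℕ → ℝ
  lab : ℕ → ℕ
  /-- the current arc of each vertex, by its head -/
  cur : ℕ → ℕ
  pos : ℕ
  act : ℕ
  run : ℕ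
  ans : ℕ

namespace PushState

open Classical in
/-- Push as much as possible along the current arc of the vertex `pos`. -/
noncomputable def tryPush (s : PushState) : PushState :=
  if 0 < s.exc s.pos ∧ s.lab (s.cur s.pos) < s.lab s.pos ∧ 0 < s.res s.pos (s.cur s.pos) then
    { s with
      res := pushRes s.res s.pos (s.cur s.pos) (min (s.exc s.pos) (s.res s.pos (s.cur s.pos)))
      exc := pushExc s.exc s.pos (s.cur s.pos) (min (s.exc s.pos) (s.res s.pos (s.cur s.pos)))
      act := 1 }
  else s

open Classical in
/-- Go on after an attempt to push: to the next arc if the vertex `pos` still has excess, with a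
relabelling when all arcs have been tried, and to the next vertex otherwise. The algorithm stops
with the answer `0` when a label reaches the number `N` of vertices. -/
noncomputable def advance (N : ℕ) (s : PushState) : PushState :=
  if 0 < s.exc s.pos then
    if s.cur s.pos + 1 < N then
      { s with cur := Function.update s.cur s.pos (s.cur s.pos + 1) }
    else
      { s with
        cur := Function.update s.cur s.pos 0
        lab := Function.update s.lab s.pos (s.lab s.pos + 1)
        act := 1
        run := if s.lab s.pos + 1 < N then s.run else 0 }
  else { s with pos := s.pos + 1 }

/-- The end of a pass: stop with the answer `1` if nothing has happened during the pass. -/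
def endPass (s : PushState) : PushState :=
  if 0 < s.act then { s with pos := 1, act := 0 } else { s with run := 0, ans := 1 }

/-- One step of the algorithm. -/
noncomputable def step (N : ℕ) (s : PushState) : PushState :=
  if s.pos < N then s.tryPush.advance N else s.endPass

/-- The invariant of the algorithm while it runs. `F` is the answer to be found. The number `H`
bounds the labels of the active vertices; it drops by one with each pass without a relabelling,
and `ρ` is `1` if there has been a relabelling during the current pass, and `0` otherwise. -/
structure Inv (N : ℕ) (F : Prop) (H ρ : ℕ) (s : PushState) : Prop where
  res_nonneg : ∀ u < N, ∀ w < N, 0 ≤ s.res u w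
  exc_nonneg : ∀ v < N, 0 ≤ s.exc v
  routable : Routable N s.res s.exc ↔ F
  lab_sink : s.lab 0 = 0
  lab_lt : ∀ v < N, s.lab v < N
  valid : ∀ u < N, ∀ w < N, 0 < s.res u w → s.lab u ≤ s.lab w + 1
  cur_lt : ∀ v < N, s.cur v < N
  /-- the arcs before the current arc are not admissible -/
  before_cur : ∀ v < N, ∀ w < s.cur v, 0 < s.res v w → s.lab v ≤ s.lab w
  pos_pos : 0 < s.pos
  pos_le : s.pos ≤ N
  lab_le : ∀ v < N, 0 < v → 0 < s.exc v → s.lab v ≤ H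
  lab_lt_of_scanned : ρ = 0 → ∀ v < N, 0 < v → v < s.pos → 0 < s.exc v → s.lab v + 1 ≤ H
  scanned_of_quiet : s.act = 0 → ∀ v, 0 < v → v < s.pos → s.exc v ≤ 0
  pos_of_active : 0 < s.act → 0 < H + ρ
  run_eq : s.run = 1
  ans_eq : s.ans = 0

/-- The potential: an upper bound for the number of steps that remain. The first summand counts
the moves to the next arc and the relabellings, the second one the passes, the third one the
vertices in the current pass. -/
def potential (N H ρ : ℕ) (s : PushState) : ℕ :=
  (N * N * N - ∑ v ∈ Finset.range N, (s.lab v * N + s.cur v))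
    + (2 * (N * N - ∑ v ∈ Finset.range N, s.lab v) + H + ρ) * N + (N - s.pos)

variable {N : ℕ} {F : Prop} {H ρ : ℕ} {s : PushState}

theorem tryPush_pos : s.tryPush.pos = s.pos := by
  unfold tryPush; split_ifs <;> rfl

theorem potential_tryPush : s.tryPush.potential N H ρ = s.potential N H ρ := by
  unfold tryPush; split_ifs <;> rfl

theorem Inv.tryPush (h : s.Inv N F H ρ) (hpos : s.pos < N) : s.tryPush.Inv N F H ρ := by
  unfold PushState.tryPush
  split_ifs with hc
  swap
  · exact h
  obtain ⟨he, hl, hr⟩ := hc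
  have hw : s.cur s.pos < N := h.cur_lt _ hpos
  have hp := h.pos_pos
  generalize hδ : min (s.exc s.pos) (s.res s.pos (s.cur s.pos)) = δ
  have hδ0 : 0 < δ := hδ ▸ lt_min he hr
  have hδe : δ ≤ s.exc s.pos := hδ ▸ min_le_left _ _
  have hδr : δ ≤ s.res s.pos (s.cur s.pos) := hδ ▸ min_le_right _ _
  have hlv : s.lab s.pos ≤ H := h.lab_le _ hpos hp he
  generalize hw' : s.cur s.pos = w at *
  generalize hv' : s.pos = v at *
  have hvw : v ≠ w := by rintro rfl; omega
  -- the only arc that can become residual is `(w, v)`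
  have hres : ∀ a b, 0 < pushRes s.res v w δ a b → (a = w ∧ b = v) ∨ 0 < s.res a b := by
    intro a b hab
    unfold pushRes at hab
    split_ifs at hab with h1 h2
    · exact .inl h1
    · obtain ⟨rfl, rfl⟩ := h2
      exact .inr hr
    · exact .inr hab
  -- the only vertex that can become active is `w`
  have hexc : ∀ a, 0 < pushExc s.exc v w δ a → a = w ∨ 0 < s.exc a := by
    intro a ha
    unfold pushExc at ha
    split_ifs at ha with h1 h2
    · exact .inl h1
    · subst h2; exact .inr he
    · exact .inr ha
  constructor <;> dsimp only
  · intro a ha b hb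
    unfold pushRes
    split_ifs with h1 h2
    · linarith [h.res_nonneg w hw v hpos]
    · linarith
    · exact h.res_nonneg a ha b hb
  · intro a ha
    unfold pushExc
    split_ifs with h1 h2
    · linarith [h.exc_nonneg w hw]
    · linarith
    · exact h.exc_nonneg a ha
  · rw [routable_push δ hpos hw hvw, h.routable]
  · exact h.lab_sink
  · exact h.lab_lt
  · intro a ha b hb hab
    rcases hres a b hab with ⟨rfl, rfl⟩ | h1
    · omega
    · exact h.valid a ha b hb h1
  · exact h.cur_lt
  · intro a ha b hb hab
    rcases hres a b hab with ⟨rfl, rfl⟩ | h1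
    · omega
    · exact h.before_cur a ha b hb h1
  · omega
  · omega
  · intro a ha ha0 hea
    rcases hexc a hea with rfl | h1
    · omega
    · exact h.lab_le a ha ha0 h1
  · intro hρ a ha ha0 hav hea
    rcases hexc a hea with rfl | h1
    · omega
    · exact h.lab_lt_of_scanned hρ a ha ha0 (by omega) h1
  · intro h0; omega
  · intro _; omega
  · exact h.run_eq
  · exact h.ans_eq

/-- After an attempt to push from a vertex which keeps excess, its current arc is not
admissible: either it was not so before, or the push has saturated it. -/
theorem current_arc_tryPush
    (he : 0 < s.tryPush.exc s.tryPush.pos)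
    (hr : 0 < s.tryPush.res s.tryPush.pos (s.tryPush.cur s.tryPush.pos)) :
    s.tryPush.lab s.tryPush.pos ≤ s.tryPush.lab (s.tryPush.cur s.tryPush.pos) := by
  unfold PushState.tryPush at *
  split_ifs at * with hc
  · obtain ⟨he', hl, hr'⟩ := hc
    have hvw : s.pos ≠ s.cur s.pos := by
      intro h1; rw [← h1] at hl; omega
    dsimp only at *
    simp only [pushExc, hvw, if_false, if_true, pushRes, and_self, false_and] at he hr
    rcases min_choice (s.exc s.pos) (s.res s.pos (s.cur s.pos)) with h1 | h1 <;>
      rw [h1] at he hr <;> linarith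
  · by_contra! hcon
    exact hc ⟨he, hcon, hr⟩

theorem sum_range_lab_le {d : ℕ → ℕ} (hd : ∀ v < N, d v < N) :
    ∑ v ∈ Finset.range N, d v ≤ N * N := by
  simpa using Finset.sum_le_card_nsmul (Finset.range N) d N
    fun v hv => (hd v (Finset.mem_range.1 hv)).le

theorem sum_range_lab_mul_add_le {d c : ℕ → ℕ} (hd : ∀ v < N, d v < N) (hc : ∀ v < N, c v < N) :
    ∑ v ∈ Finset.range N, (d v * N + c v) ≤ N * N * N := by
  refine (Finset.sum_le_card_nsmul (Finset.range N) _ (N * N) fun v hv => ?_).trans ?_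
  · have h1 := hd v (Finset.mem_range.1 hv)
    have h2 := hc v (Finset.mem_range.1 hv)
    nlinarith
  · simp [mul_assoc]

/-- What a step from a state with the invariant achieves: the invariant again, with a smaller
potential, or the right answer. -/
def Progress (N : ℕ) (F : Prop) (c : ℕ) (s : PushState) : Prop :=
  (∃ H ρ, s.Inv N F H ρ ∧ s.potential N H ρ < c) ∨
    (s.run = 0 ∧ (F → s.ans = 1) ∧ (¬ F → s.ans = 0))

theorem sum_range_of_eq_add {f g : ℕ → ℕ} {v : ℕ} (hv : v < N) (k : ℕ) (h : g v = f v + k)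
    (h' : ∀ u, u ≠ v → g u = f u) :
    ∑ u ∈ Finset.range N, g u = ∑ u ∈ Finset.range N, f u + k := by
  have hm : v ∈ Finset.range N := Finset.mem_range.2 hv
  rw [← Finset.add_sum_erase _ _ hm, ← Finset.add_sum_erase _ f hm, h,
    Finset.sum_congr rfl fun u hu => h' u (Finset.ne_of_mem_erase hu)]
  exact Nat.add_right_comm _ _ _

theorem Inv.next_arc (h : s.Inv N F H ρ) (hpos : s.pos < N)
    (harc : 0 < s.res s.pos (s.cur s.pos) → s.lab s.pos ≤ s.lab (s.cur s.pos))
    (hc : s.cur s.pos + 1 < N) :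
    PushState.Progress N F (s.potential N H ρ)
      { s with cur := Function.update s.cur s.pos (s.cur s.pos + 1) } := by
  have hcur : ∀ v < N, Function.update s.cur s.pos (s.cur s.pos + 1) v < N := by
    intro v hv
    by_cases h1 : v = s.pos
    · subst h1; simpa using hc
    · simpa [h1] using h.cur_lt v hv
  refine .inl ⟨H, ρ, { h with cur_lt := hcur, before_cur := ?_ }, ?_⟩
  · intro v hv w hw hr
    dsimp only at *
    by_cases h1 : v = s.pos
    · subst h1
      rw [Function.update_self] at hw
      rcases Nat.lt_succ_iff_lt_or_eq.1 hw with h2 | rfl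
      · exact h.before_cur _ hv w h2 hr
      · exact harc hr
    · rw [Function.update_of_ne h1] at hw
      exact h.before_cur v hv w hw hr
  · have h1 := sum_range_of_eq_add (f := fun v => s.lab v * N + s.cur v)
      (g := fun v => s.lab v * N + Function.update s.cur s.pos (s.cur s.pos + 1) v) hpos 1
      (by simp [add_assoc]) (fun u hu => by simp [hu])
    have h2 := sum_range_lab_mul_add_le h.lab_lt hcur
    simp only [potential]
    omega

/-- A relabelling raises the sum of the labels by one, and `H + ρ` by two at most, so that the
number of passes left does not grow. If the label reaches `N`, the excess cannot be routed. -/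
theorem Inv.relabel (h : s.Inv N F H ρ) (hpos : s.pos < N) (he : 0 < s.exc s.pos)
    (harc : 0 < s.res s.pos (s.cur s.pos) → s.lab s.pos ≤ s.lab (s.cur s.pos))
    (hc : ¬ s.cur s.pos + 1 < N) :
    PushState.Progress N F (s.potential N H ρ)
      { s with
        cur := Function.update s.cur s.pos 0
        lab := Function.update s.lab s.pos (s.lab s.pos + 1)
        act := 1
        run := if s.lab s.pos + 1 < N then s.run else 0 } := by
  have hp := h.pos_pos
  have hcN : s.cur s.pos + 1 = N := by have := h.cur_lt _ hpos; omega
  have hall : ∀ w < N, 0 < s.res s.pos w → s.lab s.pos ≤ s.lab w := by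
    intro w hw hr
    rcases Nat.lt_or_ge w (s.cur s.pos) with h1 | h1
    · exact h.before_cur _ hpos w h1 hr
    · obtain rfl : w = s.cur s.pos := by omega
      exact harc hr
  have hle : ∀ v, s.lab v ≤ Function.update s.lab s.pos (s.lab s.pos + 1) v := by
    intro v
    by_cases h1 : v = s.pos
    · subst h1; simp
    · simp [h1]
  have hsink : Function.update s.lab s.pos (s.lab s.pos + 1) 0 = 0 := by
    rw [Function.update_of_ne (by omega), h.lab_sink]
  have hvalid : ∀ u < N, ∀ w < N, 0 < s.res u w →
      Function.update s.lab s.pos (s.lab s.pos + 1) u ≤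
        Function.update s.lab s.pos (s.lab s.pos + 1) w + 1 := by
    intro u hu w hw hr
    by_cases h1 : u = s.pos
    · subst h1
      rw [Function.update_self]
      linarith [hall w hw hr, hle w]
    · rw [Function.update_of_ne h1]
      linarith [h.valid u hu w hw hr, hle w]
  by_cases hl : s.lab s.pos + 1 < N
  swap
  · have hF : ¬ F := fun hF => not_routable_of_label h.exc_nonneg hsink hvalid hpos hp
      (by rw [Function.update_self]; omega) he (h.routable.2 hF)
    exact .inr ⟨if_neg hl, fun hF' => absurd hF' hF, fun _ => h.ans_eq⟩
  have hlab : ∀ v < N, Function.update s.lab s.pos (s.lab s.pos + 1) v < N := by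
    intro v hv
    by_cases h1 : v = s.pos
    · subst h1; simpa using hl
    · simpa [h1] using h.lab_lt v hv
  have hcur : ∀ v < N, Function.update s.cur s.pos 0 v < N := by
    intro v hv
    by_cases h1 : v = s.pos
    · subst h1; rw [Function.update_self]; omega
    · simpa [h1] using h.cur_lt v hv
  refine .inl ⟨H + 1, 1, { h with
    lab_sink := hsink, lab_lt := hlab, valid := hvalid, cur_lt := hcur, before_cur := ?_
    lab_le := ?_, lab_lt_of_scanned := ?_, scanned_of_quiet := ?_, pos_of_active := ?_
    run_eq := ?_ }, ?_⟩
  · intro v hv w hw hr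
    dsimp only at *
    by_cases h1 : v = s.pos
    · subst h1
      rw [Function.update_self] at hw
      omega
    · rw [Function.update_of_ne h1] at hw ⊢
      exact (h.before_cur v hv w hw hr).trans (hle w)
  · intro v hv hv0 hev
    dsimp only at *
    have h2 := h.lab_le v hv hv0 hev
    by_cases h1 : v = s.pos
    · subst h1; rw [Function.update_self]; omega
    · rw [Function.update_of_ne h1]; omega
  · intro h0; omega
  · intro h0; simp at h0
  · intro _; omega
  · simp only [if_pos hl, h.run_eq]
  · have h1 := sum_range_of_eq_add (f := fun v => s.lab v * N + s.cur v)
      (g := fun v => Function.update s.lab s.pos (s.lab s.pos + 1) v * N +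
        Function.update s.cur s.pos 0 v) hpos 1
      (by simp only [Function.update_self]; rw [add_mul]; omega) (fun u hu => by simp [hu])
    have h2 := sum_range_lab_mul_add_le hlab hcur
    have h3 := sum_range_of_eq_add (f := s.lab)
      (g := Function.update s.lab s.pos (s.lab s.pos + 1)) hpos 1 (by simp)
      (fun u hu => by simp [hu])
    have h4 := sum_range_lab_le hlab
    have h5 : (2 * (N * N - ∑ v ∈ Finset.range N,
          Function.update s.lab s.pos (s.lab s.pos + 1) v) + (H + 1) + 1) * N ≤
        (2 * (N * N - ∑ v ∈ Finset.range N, s.lab v) + H + ρ) * N :=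
      Nat.mul_le_mul_right N (by omega)
    simp only [potential]
    omega

theorem Inv.next_vertex (h : s.Inv N F H ρ) (hpos : s.pos < N) (he : ¬ 0 < s.exc s.pos) :
    PushState.Progress N F (s.potential N H ρ) { s with pos := s.pos + 1 } := by
  refine .inl ⟨H, ρ, { h with
    pos_pos := Nat.succ_pos _, pos_le := hpos, lab_lt_of_scanned := ?_
    scanned_of_quiet := ?_ }, ?_⟩
  · intro hρ v hv hv0 hvp hev
    rcases Nat.lt_succ_iff_lt_or_eq.1 hvp with h1 | rfl
    · exact h.lab_lt_of_scanned hρ v hv hv0 h1 hev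
    · exact absurd hev he
  · intro ha v hv0 hvp
    rcases Nat.lt_succ_iff_lt_or_eq.1 hvp with h1 | rfl
    · exact h.scanned_of_quiet ha v hv0 h1
    · exact not_lt.1 he
  · simp only [potential]
    omega

theorem Inv.advance (h : s.Inv N F H ρ) (hpos : s.pos < N)
    (harc : 0 < s.exc s.pos → 0 < s.res s.pos (s.cur s.pos) →
      s.lab s.pos ≤ s.lab (s.cur s.pos)) :
    (s.advance N).Progress N F (s.potential N H ρ) := by
  unfold PushState.advance
  by_cases he : 0 < s.exc s.pos
  · rw [if_pos he]
    by_cases hc : s.cur s.pos + 1 < N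
    · rw [if_pos hc]
      exact h.next_arc hpos (harc he) hc
    · rw [if_neg hc]
      exact h.relabel hpos he (harc he) hc
  · rw [if_neg he]
    exact h.next_vertex hpos he

/-- A pass in which nothing has happened has found no active vertex; after any other pass,
`H + ρ` drops. -/
theorem Inv.endPass (h : s.Inv N F H ρ) (hpos : ¬ s.pos < N) :
    s.endPass.Progress N F (s.potential N H ρ) := by
  have hN : s.pos = N := by have := h.pos_le; omega
  have hp := h.pos_pos
  unfold PushState.endPass
  split_ifs with ha
  · have hHρ := h.pos_of_active ha
    -- without a relabelling all excess has moved down, so that the bound on the labels drops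
    refine .inl ⟨if ρ = 0 then H - 1 else H, 0, { h with
      pos_pos := Nat.one_pos, pos_le := by dsimp only; omega, lab_le := ?_
      lab_lt_of_scanned := ?_, scanned_of_quiet := ?_, pos_of_active := ?_ }, ?_⟩
    · intro v hv hv0 hev
      split_ifs with hρ
      · have := h.lab_lt_of_scanned hρ v hv hv0 (by omega) hev
        dsimp only at *
        omega
      · exact h.lab_le v hv hv0 hev
    · intro _ v _ hv0 hv1
      dsimp only at *
      omega
    · intro _ v hv0 hv1
      dsimp only at *
      omega
    · intro h0; simp at h0
    · have h5 : (2 * (N * N - ∑ v ∈ Finset.range N, s.lab v) +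
            (if ρ = 0 then H - 1 else H) + 0 + 1) * N ≤
          (2 * (N * N - ∑ v ∈ Finset.range N, s.lab v) + H + ρ) * N :=
        Nat.mul_le_mul_right N (by split_ifs <;> omega)
      rw [add_mul] at h5
      simp only [potential]
      omega
  · refine .inr ⟨rfl, fun _ => rfl, fun hF => absurd (h.routable.1 ?_) hF⟩
    refine routable_of_excess_eq_zero h.res_nonneg fun v hv hv0 => ?_
    exact le_antisymm (h.scanned_of_quiet (by omega) v hv0 (by omega)) (h.exc_nonneg v hv)

theorem Inv.step (h : s.Inv N F H ρ) : (s.step N).Progress N F (s.potential N H ρ) := by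
  unfold PushState.step
  split_ifs with hpos
  · have h1 := (h.tryPush hpos).advance (by rwa [tryPush_pos]) current_arc_tryPush
    rwa [potential_tryPush] at h1
  · exact h.endPass hpos

/-- The initial state has the invariant. -/
theorem inv_of_init {F : Prop} (hN : 0 < N) (hres : ∀ u < N, ∀ w < N, 0 ≤ s.res u w)
    (hexc : ∀ v < N, 0 ≤ s.exc v) (hF : Routable N s.res s.exc ↔ F) (hlab : ∀ v, s.lab v = 0)
    (hcur : ∀ v, s.cur v = 0) (hpos : s.pos = 1) (hact : s.act = 0) (hrun : s.run = 1)
    (hans : s.ans = 0) : s.Inv N F 0 0 where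
  res_nonneg := hres
  exc_nonneg := hexc
  routable := hF
  lab_sink := hlab 0
  lab_lt v _ := by rwa [hlab]
  valid u _ w _ _ := by simp [hlab]
  cur_lt v _ := by rwa [hcur]
  before_cur v _ w _ _ := by simp [hlab]
  pos_pos := by omega
  pos_le := by omega
  lab_le v _ _ _ := by simp [hlab]
  lab_lt_of_scanned _ v _ h1 h2 := by omega
  scanned_of_quiet _ v h1 h2 := by omega
  pos_of_active h := by omega
  run_eq := hrun
  ans_eq := hans

theorem potential_le (hN : 0 < N) : s.potential N 0 0 ≤ 4 * (N * N * N) := by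
  have h1 : (2 * (N * N - ∑ v ∈ Finset.range N, s.lab v) + 0 + 0) * N ≤ 2 * (N * N) * N :=
    Nat.mul_le_mul_right N (by omega)
  have h2 : N ≤ N * N * N := by nlinarith [Nat.mul_le_mul hN hN]
  have h3 : 2 * (N * N) * N = 2 * (N * N * N) := by ring
  unfold potential
  omega

end PushState

/-! ### The residual network of a funding problem -/

/-- The initial residual capacities, for `S` supervisors with the budgets `bud`, `P` projects with
the demands `dem` and the incidence matrix `inc`. Vertex `0` is the sink, vertex `i + 1` is the
supervisor `i` and vertex `S + 1 + j` is the project `j`. Funding flows from the projects to the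
supervisors and on to the sink. An arc from a project to a supervisor has the demand of the
project as its capacity, which is as good as an infinite one. -/
noncomputable def fundingRes (S P : ℕ) (inc : ℕ → ℕ → ℕ) (bud dem : ℕ → ℝ) (u w : ℕ) : ℝ :=
  if w = 0 then if 0 < u ∧ u ≤ S then bud (u - 1) else 0
  else if S < u ∧ u ≤ S + P ∧ w ≤ S ∧ 0 < inc (w - 1) (u - (S + 1)) then dem (u - (S + 1)) else 0

/-- The initial excesses: the demands of the projects. -/
noncomputable def fundingExc (S P : ℕ) (dem : ℕ → ℝ) (u : ℕ) : ℝ :=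
  if S < u ∧ u ≤ S + P then dem (u - (S + 1)) else 0

section

variable {S P : ℕ} {inc : ℕ → ℕ → ℕ} {bud dem : ℕ → ℝ}

theorem sum_range_vertices (f : ℕ → ℝ) :
    ∑ v ∈ Finset.range (S + 1 + P), f v
      = f 0 + ∑ i ∈ Finset.range S, f (i + 1) + ∑ j ∈ Finset.range P, f (S + 1 + j) := by
  rw [Finset.sum_range_add, Finset.sum_range_succ']
  ring

/-- Every vertex is the sink, a supervisor or a project. -/
theorem vertex_cases {p : ℕ → Prop} {v : ℕ} (hv : v < S + 1 + P) (h0 : p 0)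
    (hs : ∀ i < S, p (i + 1)) (hp : ∀ j < P, p (S + 1 + j)) : p v := by
  rcases Nat.eq_zero_or_pos v with rfl | h1
  · exact h0
  · rcases Nat.lt_or_ge S v with h2 | h2
    · obtain ⟨j, rfl⟩ := Nat.exists_eq_add_of_le (show S + 1 ≤ v from h2)
      exact hp j (by omega)
    · obtain ⟨i, rfl⟩ : ∃ i, v = i + 1 := ⟨v - 1, by omega⟩
      exact hs i (by omega)

theorem fundingRes_supervisor_sink {i : ℕ} (hi : i < S) :
    fundingRes S P inc bud dem (i + 1) 0 = bud i := by
  simp [fundingRes, hi]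

theorem fundingRes_project_supervisor {i j : ℕ} (hi : i < S) (hj : j < P) :
    fundingRes S P inc bud dem (S + 1 + j) (i + 1) = if 0 < inc i j then dem j else 0 := by
  have h1 : S + 1 + j ≤ S + P := by omega
  have h2 : S < S + 1 + j := by omega
  simp [fundingRes, hi, h1, h2]

theorem fundingRes_sink (w : ℕ) : fundingRes S P inc bud dem 0 w = 0 := by
  simp [fundingRes]

theorem fundingRes_project_sink (j : ℕ) : fundingRes S P inc bud dem (S + 1 + j) 0 = 0 := by
  have h1 : ¬ S + 1 + j ≤ S := by omega
  simp [fundingRes, h1]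

/-- No arc leads from a supervisor to any vertex but the sink. -/
theorem fundingRes_supervisor {i : ℕ} (hi : i < S) (w : ℕ) :
    fundingRes S P inc bud dem (i + 1) (w + 1) = 0 := by
  have h1 : ¬ S < i + 1 := by omega
  simp [fundingRes, h1]

/-- No arc leads into a project. -/
theorem fundingRes_to_project (u j : ℕ) :
    fundingRes S P inc bud dem u (S + 1 + j) = 0 := by
  have h1 : ¬ S + 1 + j ≤ S := by omega
  simp [fundingRes, h1]

theorem fundingExc_supervisor {i : ℕ} (hi : i < S) : fundingExc S P dem (i + 1) = 0 := by
  have h1 : ¬ S < i + 1 := by omega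
  simp [fundingExc, h1]

theorem fundingExc_project {j : ℕ} (hj : j < P) : fundingExc S P dem (S + 1 + j) = dem j := by
  have h1 : S + 1 + j ≤ S + P := by omega
  have h2 : S < S + 1 + j := by omega
  simp [fundingExc, h1, h2]

theorem fundingRes_nonneg (hbud : ∀ i, 0 ≤ bud i) (hdem : ∀ j, 0 ≤ dem j) (u w : ℕ) :
    0 ≤ fundingRes S P inc bud dem u w := by
  unfold fundingRes
  split_ifs <;> first | exact hbud _ | exact hdem _ | exact le_rfl

theorem fundingExc_nonneg (hdem : ∀ j, 0 ≤ dem j) (u : ℕ) : 0 ≤ fundingExc S P dem u := by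
  unfold fundingExc
  split_ifs <;> first | exact hdem _ | exact le_rfl

/-- The demands can be funded within the budgets. -/
def Fundable (S P : ℕ) (inc : ℕ → ℕ → ℕ) (bud dem : ℕ → ℝ) : Prop :=
  ∃ x : ℕ → ℕ → ℝ, (∀ i < S, ∀ j < P, 0 ≤ x i j) ∧
    (∀ i < S, ∀ j < P, inc i j = 0 → x i j = 0) ∧
    (∀ j < P, ∑ i ∈ Finset.range S, x i j = dem j) ∧
    ∀ i < S, ∑ j ∈ Finset.range P, x i j ≤ bud i

theorem Fundable.of_routable
    (h : Routable (S + 1 + P) (fundingRes S P inc bud dem) (fundingExc S P dem)) :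
    Fundable S P inc bud dem := by
  obtain ⟨r', hr, hs, hf⟩ := h
  -- wherever neither direction has capacity, nothing is routed
  have hz : ∀ u < S + 1 + P, ∀ w < S + 1 + P, fundingRes S P inc bud dem u w = 0 →
      fundingRes S P inc bud dem w u = 0 → r' u w = 0 := by
    intro u hu w hw h1 h2
    linarith [hr u hu w hw, hr w hw u hu, hs u hu w hw]
  refine ⟨fun i j => r' (i + 1) (S + 1 + j), ?_, ?_, ?_, ?_⟩
  · exact fun i hi j hj => hr _ (by omega) _ (by omega)
  · intro i hi j hj hij
    refine hz _ (by omega) _ (by omega) (fundingRes_to_project _ _) ?_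
    simp [fundingRes_project_supervisor hi hj, hij]
  · intro j hj
    have h1 := hf (S + 1 + j) (by omega) (by omega)
    rw [sum_range_vertices, fundingExc_project hj] at h1
    have h2 : r' (S + 1 + j) 0 = 0 :=
      hz _ (by omega) _ (by omega) (fundingRes_project_sink _) (fundingRes_sink _)
    have h3 : ∑ k ∈ Finset.range P, (fundingRes S P inc bud dem (S + 1 + j) (S + 1 + k)
        - r' (S + 1 + j) (S + 1 + k)) = 0 := by
      refine Finset.sum_eq_zero fun k hk => ?_
      have hk' := Finset.mem_range.1 hk
      rw [fundingRes_to_project, hz _ (by omega) _ (by omega)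
        (fundingRes_to_project _ _) (fundingRes_to_project _ _), sub_zero]
    have h4 : ∑ i ∈ Finset.range S, (fundingRes S P inc bud dem (S + 1 + j) (i + 1)
        - r' (S + 1 + j) (i + 1)) = ∑ i ∈ Finset.range S, r' (i + 1) (S + 1 + j) := by
      refine Finset.sum_congr rfl fun i hi => ?_
      have hi' := Finset.mem_range.1 hi
      have h5 := hs (S + 1 + j) (by omega) (i + 1) (by omega)
      rw [fundingRes_to_project] at h5
      linarith
    rw [h2, h3, h4, fundingRes_project_sink] at h1
    linarith
  · intro i hi
    have h1 := hf (i + 1) (by omega) (by omega)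
    rw [sum_range_vertices, fundingExc_supervisor hi, fundingRes_supervisor_sink hi] at h1
    have h3 : ∑ k ∈ Finset.range S, (fundingRes S P inc bud dem (i + 1) (k + 1)
        - r' (i + 1) (k + 1)) = 0 := by
      refine Finset.sum_eq_zero fun k hk => ?_
      have hk' := Finset.mem_range.1 hk
      rw [fundingRes_supervisor hi, hz _ (by omega) _ (by omega)
        (fundingRes_supervisor hi _) (fundingRes_supervisor hk' _), sub_zero]
    have h4 : ∑ j ∈ Finset.range P, (fundingRes S P inc bud dem (i + 1) (S + 1 + j)
        - r' (i + 1) (S + 1 + j)) = - ∑ j ∈ Finset.range P, r' (i + 1) (S + 1 + j) := by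
      rw [← Finset.sum_neg_distrib]
      refine Finset.sum_congr rfl fun j hj => ?_
      rw [fundingRes_to_project, zero_sub]
    rw [h3, h4] at h1
    linarith [hr (i + 1) (by omega) 0 (by omega)]

/-- An allocation `x` is routed by the flow that has the form of the residual capacities, with
the amount spent by a supervisor in place of its budget, and with the amounts `x i j` on the
arcs from projects to supervisors. -/
theorem Fundable.routable (h : Fundable S P inc bud dem) :
    Routable (S + 1 + P) (fundingRes S P inc bud dem) (fundingExc S P dem) := by
  obtain ⟨x, hx, hinc, hdem, hbud⟩ := h
  have hxd : ∀ i < S, ∀ j < P, x i j ≤ dem j := by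
    intro i hi j hj
    rw [← hdem j hj]
    exact Finset.single_le_sum (f := fun i => x i j)
      (fun k hk => hx k (Finset.mem_range.1 hk) j hj) (Finset.mem_range.2 hi)
  obtain ⟨g, hg⟩ : ∃ g : ℕ → ℕ → ℝ, g = fun u w =>
      if w = 0 then if 0 < u ∧ u ≤ S then ∑ j ∈ Finset.range P, x (u - 1) j else 0
      else if S < u ∧ u ≤ S + P ∧ w ≤ S then x (w - 1) (u - (S + 1)) else 0 := ⟨_, rfl⟩
  have g1 : ∀ i < S, g (i + 1) 0 = ∑ j ∈ Finset.range P, x i j := by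
    intro i hi
    simp [hg, hi]
  have g2 : ∀ i < S, ∀ j < P, g (S + 1 + j) (i + 1) = x i j := by
    intro i hi j hj
    have h1 : S + 1 + j ≤ S + P := by omega
    have h2 : S < S + 1 + j := by omega
    simp [hg, hi, h1, h2]
  have g3 : ∀ w, g 0 w = 0 := by simp [hg]
  have g4 : ∀ j, g (S + 1 + j) 0 = 0 := by
    intro j
    have h1 : ¬ S + 1 + j ≤ S := by omega
    simp [hg, h1]
  have g5 : ∀ i < S, ∀ w, g (i + 1) (w + 1) = 0 := by
    intro i hi w
    have h1 : ¬ S < i + 1 := by omega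
    simp [hg, h1]
  have g6 : ∀ u j, g u (S + 1 + j) = 0 := by
    intro u j
    have h1 : ¬ S + 1 + j ≤ S := by omega
    simp [hg, h1]
  have hg0 : ∀ u < S + 1 + P, ∀ w < S + 1 + P, 0 ≤ g u w := by
    intro u hu w hw
    refine vertex_cases (p := fun u => 0 ≤ g u w) hu (g3 w).ge (fun i hi => ?_) fun j hj => ?_
    · refine vertex_cases (p := fun w => 0 ≤ g (i + 1) w) hw ?_ (fun k hk => (g5 i hi k).ge)
        fun k hk => (g6 _ k).ge
      rw [g1 i hi]
      exact Finset.sum_nonneg fun j hj => hx i hi j (Finset.mem_range.1 hj)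
    · refine vertex_cases (p := fun w => 0 ≤ g (S + 1 + j) w) hw (g4 j).ge (fun i hi => ?_)
        fun k hk => (g6 _ k).ge
      rw [g2 i hi j hj]
      exact hx i hi j hj
  have hgr : ∀ u < S + 1 + P, ∀ w < S + 1 + P, g u w ≤ fundingRes S P inc bud dem u w := by
    intro u hu w hw
    refine vertex_cases (p := fun u => g u w ≤ fundingRes S P inc bud dem u w) hu
      (by rw [g3, fundingRes_sink]) (fun i hi => ?_) fun j hj => ?_
    · refine vertex_cases (p := fun w => g (i + 1) w ≤ fundingRes S P inc bud dem (i + 1) w) hw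
        ?_ (fun k hk => by rw [g5 i hi, fundingRes_supervisor hi])
        fun k hk => by rw [g6, fundingRes_to_project]
      rw [g1 i hi, fundingRes_supervisor_sink hi]
      exact hbud i hi
    · refine vertex_cases (p := fun w => g (S + 1 + j) w ≤
        fundingRes S P inc bud dem (S + 1 + j) w) hw
        (by rw [g4, fundingRes_project_sink]) (fun i hi => ?_)
        fun k hk => by rw [g6, fundingRes_to_project]
      rw [g2 i hi j hj, fundingRes_project_supervisor hi hj]
      split_ifs with h1
      · exact hxd i hi j hj
      · exact (hinc i hi j hj (by omega)).le
  refine ⟨fun u w => fundingRes S P inc bud dem u w - g u w + g w u, ?_, ?_, ?_⟩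
  · intro u hu w hw
    linarith [hgr u hu w hw, hg0 w hw u hu]
  · intro u hu w hw
    ring
  · intro v hv hv0
    have h1 : ∀ w, fundingRes S P inc bud dem v w
        - (fundingRes S P inc bud dem v w - g v w + g w v) = g v w - g w v := fun w => by ring
    simp_rw [h1]
    refine vertex_cases (p := fun v => 0 < v → ∑ w ∈ Finset.range (S + 1 + P), (g v w - g w v)
      = fundingExc S P dem v) hv (fun h => absurd h (lt_irrefl 0)) (fun i hi _ => ?_)
      (fun j hj _ => ?_) hv0
    · have h2 : ∑ k ∈ Finset.range S, (g (i + 1) (k + 1) - g (k + 1) (i + 1)) = 0 :=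
        Finset.sum_eq_zero fun k hk => by rw [g5 i hi, g5 k (Finset.mem_range.1 hk), sub_zero]
      have h3 : ∑ j ∈ Finset.range P, (g (i + 1) (S + 1 + j) - g (S + 1 + j) (i + 1))
          = - ∑ j ∈ Finset.range P, x i j := by
        rw [← Finset.sum_neg_distrib]
        exact Finset.sum_congr rfl fun j hj => by
          rw [g6, g2 i hi j (Finset.mem_range.1 hj), zero_sub]
      rw [sum_range_vertices, fundingExc_supervisor hi, g1 i hi, g3, h2, h3]
      ring
    · have h2 : ∑ i ∈ Finset.range S, (g (S + 1 + j) (i + 1) - g (i + 1) (S + 1 + j))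
          = ∑ i ∈ Finset.range S, x i j :=
        Finset.sum_congr rfl fun i hi => by
          rw [g6, g2 i (Finset.mem_range.1 hi) j hj, sub_zero]
      have h3 : ∑ k ∈ Finset.range P, (g (S + 1 + j) (S + 1 + k) - g (S + 1 + k) (S + 1 + j))
          = 0 := Finset.sum_eq_zero fun k _ => by rw [g6, g6, sub_zero]
      rw [sum_range_vertices, fundingExc_project hj, g4, g3, h2, h3, hdem j hj]
      ring

theorem routable_iff_fundable :
    Routable (S + 1 + P) (fundingRes S P inc bud dem) (fundingExc S P dem) ↔
      Fundable S P inc bud dem :=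
  ⟨Fundable.of_routable, Fundable.routable⟩

end

/-- For the numbers in the input memory, fundability is feasibility of the matching. -/
theorem SIP.fundable_iff_feasible {A P S : Type*} [DecidableEq P] [Fintype P] [Fintype S]
    (I : SIP A P S) (M : Finset (A × P))
    (eS : S ≃ Fin (Fintype.card S)) (eP : P ≃ Fin (Fintype.card P)) :
    Fundable (Fintype.card S) (Fintype.card P) ((I.inputMemory M eS eP).idxArr 0)
      (fun i => (I.inputMemory M eS eP).numArr 0 i 0)
      (fun j => (I.inputMemory M eS eP).numArr 1 j 0) ↔ I.Feasible M := by
  have hinc : ∀ s p, (I.inputMemory M eS eP).idxArr 0 (eS s) (eP p)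
      = if p ∈ I.supervised s then 1 else 0 := by
    intro s p
    simp [inputMemory]
  have hbud : ∀ s, (I.inputMemory M eS eP).numArr 0 (eS s) 0 = I.budget s := by
    intro s
    simp [inputMemory]
  have hdem : ∀ p, (I.inputMemory M eS eP).numArr 1 (eP p) 0 = matchedCount M p := by
    intro p
    simp [inputMemory]
  have sumS : ∀ f : ℕ → ℝ, ∑ i ∈ Finset.range (Fintype.card S), f i = ∑ s, f (eS s) := by
    intro f
    rw [Finset.sum_range, Equiv.sum_comp eS (fun i : Fin _ => f i)]
  have sumP : ∀ f : ℕ → ℝ, ∑ i ∈ Finset.range (Fintype.card P), f i = ∑ p, f (eP p) := by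
    intro f
    rw [Finset.sum_range, Equiv.sum_comp eP (fun i : Fin _ => f i)]
  have memS : ∀ {q : ℕ → Prop}, (∀ i < Fintype.card S, q i) ↔ ∀ s, q (eS s) := by
    intro q
    refine ⟨fun h s => h _ (eS s).2, fun h i hi => ?_⟩
    simpa using h (eS.symm ⟨i, hi⟩)
  have memP : ∀ {q : ℕ → Prop}, (∀ i < Fintype.card P, q i) ↔ ∀ p, q (eP p) := by
    intro q
    refine ⟨fun h s => h _ (eP s).2, fun h i hi => ?_⟩
    simpa using h (eP.symm ⟨i, hi⟩)
  simp only [Fundable, memS, memP, sumS, sumP, hinc, hbud, hdem]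
  constructor
  · rintro ⟨x, h1, h2, h3, h4⟩
    refine ⟨fun s p => x (eS s) (eP p), fun s p _ => h1 s p, fun p => ?_, fun s => ?_⟩
    · rw [← h3 p, Finset.sum_filter]
      refine Finset.sum_congr rfl fun s _ => ?_
      split_ifs with h
      · rfl
      · exact (h2 s p (if_neg h)).symm
    · exact (Finset.sum_le_sum_of_subset_of_nonneg (Finset.subset_univ _)
        fun p _ _ => h1 s p).trans (h4 s)
  · rintro ⟨x, h1, h2, h3⟩
    obtain ⟨y, hy⟩ : ∃ y : ℕ → ℕ → ℝ, ∀ s p, y (eS s) (eP p) =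
        if p ∈ I.supervised s then x s p else 0 := by
      refine ⟨fun i j => if h : i < Fintype.card S ∧ j < Fintype.card P then
        if eP.symm ⟨j, h.2⟩ ∈ I.supervised (eS.symm ⟨i, h.1⟩) then
          x (eS.symm ⟨i, h.1⟩) (eP.symm ⟨j, h.2⟩) else 0 else 0, fun s p => ?_⟩
      simp
    refine ⟨y, fun s p => ?_, fun s p h => ?_, fun p => ?_, fun s => ?_⟩
    · rw [hy]
      split_ifs with h
      · exact h1 s p h
      · exact le_rfl
    · rw [hy, if_neg]
      intro h'
      simp [h'] at h
    · simp_rw [hy, ← Finset.sum_filter]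
      exact h2 p
    · simp_rw [hy, Finset.sum_ite_mem, Finset.univ_inter]
      exact h3 s

/-! ### Total correctness of programs, with running times -/

/-- The program `c`, started on `m`, halts, and its running time and final memory satisfy `Q`. -/
def Halts (c : Program) (m : Memory) (Q : ℕ → Memory → Prop) : Prop :=
  ∃ t m', Exec c m t m' ∧ Q t m'

section

variable {c d : Program} {b : Comparison} {m : Memory} {Q R : ℕ → Memory → Prop}

theorem Halts.mono (h : Halts c m Q) (hQ : ∀ t m', Q t m' → R t m') : Halts c m R :=
  let ⟨t, m', h1, h2⟩ := h
  ⟨t, m', h1, hQ t m' h2⟩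

@[simp] theorem halts_instr_iff {i : Instr} : Halts (.instr i) m Q ↔ Q 1 (i.apply m) :=
  ⟨fun ⟨_, _, h1, h2⟩ => by cases h1; exact h2, fun h => ⟨_, _, .instr i m, h⟩⟩

@[simp] theorem halts_skip_iff : Halts .skip m Q ↔ Q 1 m :=
  ⟨fun ⟨_, _, h1, h2⟩ => by cases h1; exact h2, fun h => ⟨_, _, .skip m, h⟩⟩

@[simp] theorem halts_seq_iff :
    Halts (.seq c d) m Q ↔ Halts c m fun t m' => Halts d m' fun t' m'' => Q (t + t') m'' := by
  constructor
  · rintro ⟨_, _, h1, h2⟩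
    cases h1 with
    | seq h3 h4 => exact ⟨_, _, h3, _, _, h4, h2⟩
  · rintro ⟨_, _, h3, _, _, h4, h2⟩
    exact ⟨_, _, .seq h3 h4, h2⟩

theorem halts_branch_of_holds (h : b.Holds m) :
    Halts (.branch b c d) m Q ↔ Halts c m fun t m' => Q (t + 1) m' := by
  constructor
  · rintro ⟨_, _, h1, h2⟩
    cases h1 with
    | branch_true _ h3 => exact ⟨_, _, h3, h2⟩
    | branch_false h4 _ => exact absurd h h4
  · rintro ⟨_, _, h3, h2⟩
    exact ⟨_, _, .branch_true h h3, h2⟩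

theorem halts_branch_of_not_holds (h : ¬ b.Holds m) :
    Halts (.branch b c d) m Q ↔ Halts d m fun t m' => Q (t + 1) m' := by
  constructor
  · rintro ⟨_, _, h1, h2⟩
    cases h1 with
    | branch_true h4 _ => exact absurd h4 h
    | branch_false _ h3 => exact ⟨_, _, h3, h2⟩
  · rintro ⟨_, _, h3, h2⟩
    exact ⟨_, _, .branch_false h h3, h2⟩

open Classical in
@[simp] theorem halts_branch_iff :
    Halts (.branch b c d) m Q ↔
      if b.Holds m then Halts c m fun t m' => Q (t + 1) m'
      else Halts d m fun t m' => Q (t + 1) m' := by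
  split_ifs with h
  · exact halts_branch_of_holds h
  · exact halts_branch_of_not_holds h

/-- The rule for loops, with amortized costs: `I k m` says that the loop invariant holds and that
`k` steps suffice for the rest of the loop; each iteration pays for itself out of `k`. -/
theorem Halts.loop (I : ℕ → Memory → Prop) {k : ℕ} (hI : I k m)
    (hstep : ∀ k m, I k m → b.Holds m →
      Halts c m fun t m' => ∃ k', I k' m' ∧ t + 1 + k' ≤ k)
    (hend : ∀ k m, I k m → ¬ b.Holds m → 1 ≤ k) :
    Halts (.loop b c) m fun t m' => t ≤ k ∧ ¬ b.Holds m' ∧ ∃ k', I k' m' := by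
  induction k using Nat.strong_induction_on generalizing m with
  | _ k ih =>
    by_cases hb : b.Holds m
    · obtain ⟨t₁, m₁, h1, k', h2, h3⟩ := hstep k m hI hb
      obtain ⟨t₂, m₂, h4, h5, h6⟩ := ih k' (by omega) h2
      exact ⟨_, _, .loop_true hb h1 h4, by omega, h6⟩
    · exact ⟨1, m, .loop_false hb, hend k m hI hb, hb, k, hI⟩

end

/-! ### The program -/

namespace Program

/-- Sequential composition of the programs in a list. -/
def block : List Program → Program
  | [] => .skip
  | [c] => c
  | c :: d :: l => .seq c (block (d :: l))

end Program

open Program Instr Comparison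

/-- The part of the memory that represents the data of the push-relabel algorithm. The number of
vertices is in index register 2; the index registers from 7 on and the number registers from 1 on
are scratch registers. Index register 6 and number register 0 stay zero; the former is also the
second index of the arrays that are used as vectors. -/
def Memory.pushState (m : Memory) : PushState where
  res := m.numArr 2
  exc v := m.numArr 3 v 0
  lab v := m.idxArr 1 v 0
  cur v := m.idxArr 2 v 0
  pos := m.idx 3
  act := m.idx 4
  run := m.idx 5
  ans := m.idx 0

/-- The constants that the main loop uses are in place: the number of vertices and the zeros. -/
def Memory.Ready (N : ℕ) (m : Memory) : Prop :=
  m.idx 2 = N ∧ m.idx 6 = 0 ∧ m.num 0 = 0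

/-- Push along the current arc `(v, w)`; here `v` and `w` are in the index registers 3 and 7,
the excess of `v` and the residual capacity of the arc in the number registers 1 and 2. -/
def pushProgram : Program := block [
  .branch (numLt 1 2) (.instr (numCopy 3 1)) (.instr (numCopy 3 2)),
  .instr (numSub 1 1 3), .instr (numStore 3 3 6 1),
  .instr (numLoad 1 3 7 6), .instr (numAdd 1 1 3), .instr (numStore 3 7 6 1),
  .instr (numSub 2 2 3), .instr (numStore 2 3 7 2),
  .instr (numLoad 2 2 7 3), .instr (numAdd 2 2 3), .instr (numStore 2 7 3 2),
  .instr (idxZero 4), .instr (idxSucc 4 4)]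

/-- `PushState.tryPush` as a program. -/
def tryPushProgram : Program := block [
  .instr (idxLoad 7 2 3 6), .instr (idxLoad 8 1 3 6), .instr (idxLoad 9 1 7 6),
  .instr (numLoad 1 3 3 6), .instr (numLoad 2 2 3 7),
  .branch (numLt 0 1)
    (.branch (idxLt 9 8) (.branch (numLt 0 2) pushProgram .skip) .skip) .skip]

/-- `PushState.advance` as a program. -/
def advanceProgram : Program := block [
  .instr (numLoad 1 3 3 6),
  .branch (numLt 0 1)
    (block [
      .instr (idxLoad 7 2 3 6), .instr (idxSucc 7 7),
      .branch (idxLt 7 2)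
        (.instr (idxStore 2 3 6 7))
        (block [
          .instr (idxStore 2 3 6 6),
          .instr (idxLoad 8 1 3 6), .instr (idxSucc 8 8), .instr (idxStore 1 3 6 8),
          .instr (idxZero 4), .instr (idxSucc 4 4),
          .branch (idxLt 8 2) .skip (.instr (idxZero 5))])])
    (.instr (idxSucc 3 3))]

/-- `PushState.endPass` as a program. -/
def endPassProgram : Program :=
  .branch (idxLt 6 4)
    (block [.instr (idxSucc 3 6), .instr (idxZero 4)])
    (block [.instr (idxZero 5), .instr (idxSucc 0 6)])

/-- `PushState.step` as a program; it contains no loop. -/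
def stepProgram : Program :=
  .branch (idxLt 3 2) (.seq tryPushProgram advanceProgram) endPassProgram

section

variable {α : Type*} {arr : ℕ → ℕ → ℕ → α} {k k' i j : ℕ} {z : α}

theorem setCell_of_ne (h : k' ≠ k) : setCell arr k i j z k' = arr k' := by
  funext a b
  simp [setCell, h]

theorem setCell_column (a : ℕ) :
    setCell arr k i 0 z k a 0 = Function.update (fun v => arr k v 0) i z a := by
  simp [setCell, Function.update_apply]

end

theorem halts_tryPushProgram {N : ℕ} {m : Memory} (hm : m.Ready N) :
    Halts tryPushProgram m fun t m' =>
      t ≤ 25 ∧ m'.Ready N ∧ m'.pushState = m.pushState.tryPush := by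
  obtain ⟨h2, h6, h0⟩ := hm
  by_cases h : 0 < m.pushState.exc m.pushState.pos ∧
      m.pushState.lab (m.pushState.cur m.pushState.pos) < m.pushState.lab m.pushState.pos ∧
      0 < m.pushState.res m.pushState.pos (m.pushState.cur m.pushState.pos)
  · have hvw : m.pushState.pos ≠ m.pushState.cur m.pushState.pos := by
      intro h1; rw [← h1] at h; omega
    rw [PushState.tryPush, if_pos h]
    simp only [Memory.pushState] at h hvw
    rcases lt_or_ge (m.numArr 3 (m.idx 3) 0) (m.numArr 2 (m.idx 3) (m.idxArr 2 (m.idx 3) 0))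
      with hlt | hlt
    · simp [tryPushProgram, pushProgram, block, Instr.apply, h6, Holds, h0, h, hlt, Memory.Ready,
        h2, Memory.pushState, setCell_of_ne]
      constructor
      · funext a b
        simp [setCell, pushRes, min_eq_left hlt.le, hvw.symm]
      · funext a
        simp [setCell, pushExc, min_eq_left hlt.le, hvw.symm]
    · simp [tryPushProgram, pushProgram, block, Instr.apply, h6, Holds, h0, h, hlt.not_gt,
        Memory.Ready, h2, Memory.pushState, setCell_of_ne]
      constructor
      · funext a b
        simp [setCell, pushRes, min_eq_right hlt, hvw.symm]
      · funext a
        simp [setCell, pushExc, min_eq_right hlt, hvw.symm]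
  · rw [PushState.tryPush, if_neg h]
    simp only [Memory.pushState] at h
    by_cases he : 0 < m.numArr 3 (m.idx 3) 0
    · by_cases hl : m.idxArr 1 (m.idxArr 2 (m.idx 3) 0) 0 < m.idxArr 1 (m.idx 3) 0
      · have hr : ¬ 0 < m.numArr 2 (m.idx 3) (m.idxArr 2 (m.idx 3) 0) :=
          fun hr => h ⟨he, hl, hr⟩
        simp [tryPushProgram, block, Instr.apply, h6, Holds, h0, Memory.Ready, h2,
          Memory.pushState, he, hl, hr]
      · simp [tryPushProgram, block, Instr.apply, h6, Holds, h0, Memory.Ready, h2,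
          Memory.pushState, he, hl]
    · simp [tryPushProgram, block, Instr.apply, h6, Holds, h0, Memory.Ready, h2,
        Memory.pushState, he]

theorem halts_advanceProgram {N : ℕ} {m : Memory} (hm : m.Ready N) :
    Halts advanceProgram m fun t m' =>
      t ≤ 15 ∧ m'.Ready N ∧ m'.pushState = m.pushState.advance N := by
  obtain ⟨h2, h6, h0⟩ := hm
  by_cases he : 0 < m.numArr 3 (m.idx 3) 0
  · by_cases hc : m.idxArr 2 (m.idx 3) 0 + 1 < N
    · simp [advanceProgram, block, Instr.apply, h6, Holds, h0, h2, PushState.advance,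
        Memory.pushState, Memory.Ready, he, hc, setCell_of_ne, setCell_column]
    · by_cases hl : m.idxArr 1 (m.idx 3) 0 + 1 < N <;>
        simp [advanceProgram, block, Instr.apply, h6, Holds, h0, h2, PushState.advance,
          Memory.pushState, Memory.Ready, he, hc, hl, setCell_of_ne, setCell_column]
  · simp [advanceProgram, block, Instr.apply, h6, Holds, h0, h2, PushState.advance,
      Memory.pushState, Memory.Ready, he]

theorem halts_endPassProgram {N : ℕ} {m : Memory} (hm : m.Ready N) :
    Halts endPassProgram m fun t m' =>
      t ≤ 5 ∧ m'.Ready N ∧ m'.pushState = m.pushState.endPass := by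
  obtain ⟨h2, h6, h0⟩ := hm
  by_cases h : 0 < m.idx 4 <;>
    simp [endPassProgram, block, Instr.apply, h6, Holds, PushState.endPass, Memory.pushState,
      Memory.Ready, h, h2, h0]

theorem halts_stepProgram {N : ℕ} {m : Memory} (hm : m.Ready N) :
    Halts stepProgram m fun t m' =>
      t ≤ 45 ∧ m'.Ready N ∧ m'.pushState = m.pushState.step N := by
  have h2 : m.idx 2 = N := hm.1
  by_cases h : m.idx 3 < N
  · have hstep : m.pushState.step N = m.pushState.tryPush.advance N := if_pos h
    rw [stepProgram, halts_branch_of_holds (by rwa [Holds, h2]), halts_seq_iff, hstep]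
    refine (halts_tryPushProgram hm).mono fun t m₁ ⟨ht, hm₁, hs₁⟩ => ?_
    refine (halts_advanceProgram hm₁).mono fun t' m₂ ⟨ht', hm₂, hs₂⟩ => ?_
    exact ⟨by omega, hm₂, by rw [hs₂, hs₁]⟩
  · have hstep : m.pushState.step N = m.pushState.endPass := if_neg h
    rw [stepProgram, halts_branch_of_not_holds (by rwa [Holds, h2]), hstep]
    exact (halts_endPassProgram hm).mono fun t m₁ ⟨ht, hm₁, hs₁⟩ => ⟨by omega, hm₁, hs₁⟩

/-- Steps of the algorithm until it stops. -/
def mainLoop : Program := .loop (idxLt 6 5) stepProgram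

/-- Started on a state with the invariant, the main loop finds the answer in a time that is
proportional to the potential. -/
theorem halts_mainLoop {N : ℕ} {F : Prop} {H ρ : ℕ} {m : Memory} (hm : m.Ready N)
    (hinv : m.pushState.Inv N F H ρ) :
    Halts mainLoop m fun t m' =>
      t ≤ 46 * m.pushState.potential N H ρ + 47 ∧ (F → m'.idx 0 = 1) ∧ (¬ F → m'.idx 0 = 0) := by
  -- each step is paid by a drop of the potential; 46 more are for the step that stops
  refine (Halts.loop (fun k m => m.Ready N ∧
    ((∃ H ρ, m.pushState.Inv N F H ρ ∧ 46 * m.pushState.potential N H ρ + 47 ≤ k) ∨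
      (m.pushState.run = 0 ∧ (F → m.pushState.ans = 1) ∧ (¬ F → m.pushState.ans = 0) ∧ 1 ≤ k)))
    (k := 46 * m.pushState.potential N H ρ + 47) ⟨hm, .inl ⟨H, ρ, hinv, le_rfl⟩⟩ ?_ ?_).mono ?_
  · rintro k m ⟨hm, ⟨H, ρ, hinv, hk⟩ | ⟨hrun, -⟩⟩ hb
    · refine (halts_stepProgram hm).mono fun t m₁ ⟨ht, hm₁, hs₁⟩ => ?_
      rcases hinv.step with ⟨H', ρ', hinv', hlt⟩ | ⟨h1, h2, h3⟩
      · rw [← hs₁] at hinv' hlt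
        exact ⟨46 * m₁.pushState.potential N H' ρ' + 47, ⟨hm₁, .inl ⟨H', ρ', hinv', le_rfl⟩⟩,
          by omega⟩
      · rw [← hs₁] at h1 h2 h3
        exact ⟨1, ⟨hm₁, .inr ⟨h1, h2, h3, le_rfl⟩⟩, by omega⟩
    · change m.idx 6 < m.idx 5 at hb
      change m.idx 5 = 0 at hrun
      omega
  · rintro k m ⟨-, ⟨H, ρ, -, hk⟩ | ⟨-, -, -, hk⟩⟩ - <;> omega
  · rintro t m' ⟨ht, hb, k, hm', ⟨H, ρ, hinv, -⟩ | ⟨-, h1, h2, -⟩⟩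
    · have h1 : m'.idx 5 = 1 := hinv.run_eq
      have h2 : m'.idx 6 = 0 := hm'.2.1
      change ¬ m'.idx 6 < m'.idx 5 at hb
      omega
    · exact ⟨ht, h1, h2⟩

/-! ### Setting up the residual network -/

/-- The supervisor with the number in index register 8 gets its arc from the vertex in index
register 2, which is the project with the number in index register 7. -/
def arcProgram : Program := block [
  .instr (idxLoad 9 0 8 7), .instr (idxSucc 8 8),
  .branch (idxLt 6 9) (.instr (numStore 2 2 8 1)) .skip]

/-- The project with the number in index register 7, which becomes the vertex in index register 2,
gets its excess and its arcs. -/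
def projectProgram : Program := block [
  .instr (numLoad 1 1 7 6), .instr (numStore 3 2 6 1), .instr (idxZero 8),
  .loop (idxLt 8 0) arcProgram,
  .instr (idxSucc 7 7), .instr (idxSucc 2 2)]

/-- The supervisor with the number in index register 7 gets its arc to the sink. -/
def supervisorProgram : Program := block [
  .instr (numLoad 1 0 7 6), .instr (idxSucc 7 7), .instr (numStore 2 7 6 1)]

/-- Enter the residual capacities and the excesses. The vertex number in index register 2 runs
through the projects and ends as the number of vertices. Labels and current arcs need no
initialization because the unused memory is zero. -/
def setupProgram : Program := block [
  .instr (idxSucc 2 0),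
  .loop (idxLt 7 1) projectProgram,
  .instr (idxZero 7),
  .loop (idxLt 7 0) supervisorProgram,
  .instr (idxSucc 3 6), .instr (idxSucc 5 6), .instr (idxZero 0)]

theorem halts_arcLoop {m : Memory} (h6 : m.idx 6 = 0) (h8 : m.idx 8 = 0) :
    Halts (.loop (idxLt 8 0) arcProgram) m fun t m' =>
      t ≤ 6 * m.idx 0 + 1 ∧ (∀ x < 8, m'.idx x = m.idx x) ∧ m'.idxArr = m.idxArr ∧
      m'.num = m.num ∧ (∀ k, k ≠ 2 → m'.numArr k = m.numArr k) ∧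
      ∀ u w, m'.numArr 2 u w =
        if u = m.idx 2 ∧ 0 < w ∧ w ≤ m.idx 0 ∧ 0 < m.idxArr 0 (w - 1) (m.idx 7) then m.num 1
        else m.numArr 2 u w := by
  refine (Halts.loop (fun k m' => m'.idx 8 ≤ m.idx 0 ∧
    6 * (m.idx 0 - m'.idx 8) + 1 ≤ k ∧ (∀ x < 8, m'.idx x = m.idx x) ∧ m'.idxArr = m.idxArr ∧
    m'.num = m.num ∧ (∀ k, k ≠ 2 → m'.numArr k = m.numArr k) ∧
    ∀ u w, m'.numArr 2 u w =
      if u = m.idx 2 ∧ 0 < w ∧ w ≤ m'.idx 8 ∧ 0 < m.idxArr 0 (w - 1) (m.idx 7) then m.num 1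
      else m.numArr 2 u w) (k := 6 * m.idx 0 + 1) ⟨by omega, by omega, fun _ _ => rfl, rfl, rfl,
        fun _ _ => rfl, fun u w => ?_⟩ ?_ ?_).mono ?_
  · rw [if_neg]; omega
  · rintro k m₁ ⟨h1, hk, hidx, harr, hnum, hk2, hres⟩ hb
    change m₁.idx 8 < m₁.idx 0 at hb
    rw [hidx 0 (by norm_num)] at hb
    have e6 : m₁.idx 6 = 0 := by rw [hidx 6 (by norm_num), h6]
    have e7 := hidx 7 (by norm_num)
    have e2 := hidx 2 (by norm_num)
    by_cases hinc : 0 < m.idxArr 0 (m₁.idx 8) (m.idx 7)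
    · simp [arcProgram, block, Instr.apply, Holds, e6, e7, e2, harr, hnum, hinc]
      refine ⟨6 * (m.idx 0 - (m₁.idx 8 + 1)) + 1,
        ⟨by omega, by omega, fun x hx => ?_, fun k hk => ?_, fun u w => ?_⟩, by omega⟩
      · rw [Function.update_of_ne (by omega), Function.update_of_ne (by omega), hidx x hx]
      · rw [setCell_of_ne hk, hk2 k hk]
      · simp only [setCell, hres, true_and]
        by_cases hw : w = m₁.idx 8 + 1
        · subst hw
          by_cases hu : u = m.idx 2
          · simp [hu, hinc]
          · simp [hu]
        · have hw' : w ≤ m₁.idx 8 + 1 ↔ w ≤ m₁.idx 8 := by omega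
          simp [hw, hw']
    · simp [arcProgram, block, Instr.apply, Holds, e6, e7, harr, hnum, hinc]
      refine ⟨6 * (m.idx 0 - (m₁.idx 8 + 1)) + 1,
        ⟨by omega, by omega, fun x hx => ?_, hk2, fun u w => ?_⟩, by omega⟩
      · rw [Function.update_of_ne (by omega), Function.update_of_ne (by omega), hidx x hx]
      · rw [hres]
        by_cases hw : w = m₁.idx 8 + 1
        · subst hw
          simp [hinc]
        · have hw' : w ≤ m₁.idx 8 + 1 ↔ w ≤ m₁.idx 8 := by omega
          simp [hw']
  · rintro k m₁ ⟨-, hk, -⟩ -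
    omega
  · rintro t m₁ ⟨ht, hb, k, h1, -, hidx, harr, hnum, hk2, hres⟩
    change ¬ m₁.idx 8 < m₁.idx 0 at hb
    rw [hidx 0 (by norm_num)] at hb
    have e8 : m₁.idx 8 = m.idx 0 := by omega
    rw [e8] at hres
    exact ⟨ht, hidx, harr, hnum, hk2, hres⟩

/-- The memory as it is when the projects below `j` have been entered into the network. -/
structure ProjectsEntered (S P : ℕ) (m₀ : Memory) (j : ℕ) (m : Memory) : Prop where
  idx_zero : m.idx 0 = S
  idx_one : m.idx 1 = P
  idx_two : m.idx 2 = S + 1 + j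
  idx_eq_zero : ∀ x, 3 ≤ x → x < 7 → m.idx x = 0
  idx_seven : m.idx 7 = j
  num_zero : m.num 0 = 0
  idxArr_eq : m.idxArr = m₀.idxArr
  numArr_zero : m.numArr 0 = m₀.numArr 0
  numArr_one : m.numArr 1 = m₀.numArr 1
  res_eq : ∀ u w, m.numArr 2 u w =
    fundingRes S j (m₀.idxArr 0) (fun _ => 0) (fun j => m₀.numArr 1 j 0) u w
  exc_eq : ∀ u, m.numArr 3 u 0 = fundingExc S j (fun j => m₀.numArr 1 j 0) u

theorem fundingExc_succ (S j : ℕ) (dem : ℕ → ℝ) (u : ℕ) :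
    fundingExc S (j + 1) dem u = if u = S + 1 + j then dem j else fundingExc S j dem u := by
  unfold fundingExc
  by_cases h : u = S + 1 + j
  · have h1 : S < u ∧ u ≤ S + (j + 1) := by omega
    rw [if_pos h1, if_pos h, h, Nat.add_sub_cancel_left]
  · have h1 : u ≤ S + (j + 1) ↔ u ≤ S + j := by omega
    rw [if_neg h]
    simp only [h1]

theorem fundingRes_succ (S j : ℕ) (inc : ℕ → ℕ → ℕ) (dem : ℕ → ℝ) (u w : ℕ) :
    fundingRes S (j + 1) inc (fun _ => 0) dem u w =
      if u = S + 1 + j ∧ 0 < w ∧ w ≤ S ∧ 0 < inc (w - 1) j then dem j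
      else fundingRes S j inc (fun _ => 0) dem u w := by
  unfold fundingRes
  rcases Nat.eq_zero_or_pos w with rfl | hw
  · simp
  · have hw' : w ≠ 0 := by omega
    by_cases h : u = S + 1 + j
    · have h1 : S < S + 1 + j := by omega
      have h2 : S + 1 + j ≤ S + (j + 1) := by omega
      have h3 : ¬ S + 1 + j ≤ S + j := by omega
      simp [hw', hw, h1, h2, h3, h]
    · have h1 : u ≤ S + (j + 1) ↔ u ≤ S + j := by omega
      simp [hw', h, h1]

theorem ProjectsEntered.halts_projectProgram {S P j : ℕ} {m₀ m : Memory}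
    (h : ProjectsEntered S P m₀ j m) :
    Halts projectProgram m fun t m' =>
      t ≤ 6 * S + 6 ∧ ProjectsEntered S P m₀ (j + 1) m' := by
  have h6 := h.idx_eq_zero 6 (by norm_num) (by norm_num)
  simp only [projectProgram, block, halts_seq_iff, halts_instr_iff, Instr.apply]
  refine (halts_arcLoop (by simpa using h6) (by simp)).mono
    fun t m₁ ⟨ht, hidx, harr, hnum, hk2, hres⟩ => ?_
  simp [h.idx_zero, h.idx_two, h6, h.idx_seven, h.idxArr_eq, h.numArr_one, setCell_of_ne]
    at ht hres harr hnum
  have hidx' : ∀ x < 8, m₁.idx x = m.idx x := by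
    intro x hx
    rw [hidx x hx]
    exact Function.update_of_ne (by omega) _ _
  refine ⟨by omega, ?_⟩
  constructor
  · simp [hidx', h.idx_zero]
  · simp [hidx', h.idx_one]
  · simp [hidx', h.idx_two, add_assoc]
  · intro x h3 h7
    dsimp only
    rw [Function.update_of_ne (by omega), Function.update_of_ne (by omega), hidx' x (by omega),
      h.idx_eq_zero x h3 h7]
  · simp [hidx', h.idx_seven]
  · simp [hnum, h.num_zero]
  · exact harr
  · simp [hk2, setCell_of_ne, h.numArr_zero]
  · simp [hk2, setCell_of_ne, h.numArr_one]
  · intro u w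
    dsimp only
    rw [hres, fundingRes_succ, h.res_eq]
  · intro u
    dsimp only
    rw [hk2 3 (by norm_num)]
    simp only [fundingExc_succ, h.idx_two, h6, h.idx_seven, h.numArr_one, setCell,
      Function.update_self, true_and, and_true, h.exc_eq]

theorem ProjectsEntered.halts_loop {S P : ℕ} {m₀ m : Memory} (h : ProjectsEntered S P m₀ 0 m) :
    Halts (.loop (idxLt 7 1) projectProgram) m fun t m' =>
      t ≤ (6 * S + 7) * P + 1 ∧ ProjectsEntered S P m₀ P m' := by
  refine (Halts.loop (fun k m' => ∃ j, ∃ i, i + j = P ∧ (6 * S + 7) * i + 1 ≤ k ∧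
    ProjectsEntered S P m₀ j m') (k := (6 * S + 7) * P + 1) ⟨0, P, by omega, le_rfl, h⟩
    ?_ ?_).mono ?_
  · rintro k m₁ ⟨j, i, hij, hk, h1⟩ hb
    change m₁.idx 7 < m₁.idx 1 at hb
    rw [h1.idx_seven, h1.idx_one] at hb
    obtain ⟨i, rfl⟩ : ∃ i', i = i' + 1 := ⟨i - 1, by omega⟩
    rw [mul_add] at hk
    exact h1.halts_projectProgram.mono fun t m₂ ⟨ht, h2⟩ =>
      ⟨(6 * S + 7) * i + 1, ⟨j + 1, i, by omega, le_rfl, h2⟩, by omega⟩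
  · rintro k m₁ ⟨j, i, -, hk, -⟩ -
    omega
  · rintro t m₁ ⟨ht, hb, k, j, i, hij, -, h1⟩
    change ¬ m₁.idx 7 < m₁.idx 1 at hb
    rw [h1.idx_seven, h1.idx_one] at hb
    obtain rfl : j = P := by omega
    exact ⟨ht, h1⟩

/-- The memory as it is when moreover the supervisors below `i` have been given their budgets. -/
structure BudgetsEntered (S P : ℕ) (m₀ : Memory) (i : ℕ) (m : Memory) : Prop where
  idx_zero : m.idx 0 = S
  idx_two : m.idx 2 = S + 1 + P
  idx_eq_zero : ∀ x, 3 ≤ x → x < 7 → m.idx x = 0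
  idx_seven : m.idx 7 = i
  num_zero : m.num 0 = 0
  idxArr_eq : m.idxArr = m₀.idxArr
  numArr_zero : m.numArr 0 = m₀.numArr 0
  res_eq : ∀ u w, m.numArr 2 u w = fundingRes S P (m₀.idxArr 0)
    (fun k => if k < i then m₀.numArr 0 k 0 else 0) (fun j => m₀.numArr 1 j 0) u w
  exc_eq : ∀ u, m.numArr 3 u 0 = fundingExc S P (fun j => m₀.numArr 1 j 0) u

theorem fundingRes_budget_succ {S P i : ℕ} (hi : i < S) (inc : ℕ → ℕ → ℕ) (bud dem : ℕ → ℝ)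
    (u w : ℕ) :
    fundingRes S P inc (fun k => if k < i + 1 then bud k else 0) dem u w =
      if u = i + 1 ∧ w = 0 then bud i
      else fundingRes S P inc (fun k => if k < i then bud k else 0) dem u w := by
  unfold fundingRes
  by_cases hw : w = 0
  · by_cases hu : u = i + 1
    · have h1 : i + 1 ≤ S := hi
      simp [hw, hu, h1]
    · by_cases h1 : 0 < u ∧ u ≤ S
      · have h2 : u - 1 < i + 1 ↔ u - 1 < i := by omega
        simp [hw, hu, h1, h2]
      · simp [hw, hu, h1]
  · simp [hw]

theorem BudgetsEntered.halts_supervisorProgram {S P i : ℕ} {m₀ m : Memory} (hi : i < S)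
    (h : BudgetsEntered S P m₀ i m) :
    Halts supervisorProgram m fun t m' => t ≤ 3 ∧ BudgetsEntered S P m₀ (i + 1) m' := by
  have h6 := h.idx_eq_zero 6 (by norm_num) (by norm_num)
  simp only [supervisorProgram, block, halts_seq_iff, halts_instr_iff, Instr.apply]
  refine ⟨by omega, ?_⟩
  constructor
  · simp [h.idx_zero]
  · simp [h.idx_two]
  · intro x h3 h7
    dsimp only
    rw [Function.update_of_ne (by omega), h.idx_eq_zero x h3 h7]
  · simp [h.idx_seven]
  · simp [h.num_zero]
  · exact h.idxArr_eq
  · simp [setCell_of_ne, h.numArr_zero]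
  · intro u w
    rw [fundingRes_budget_succ hi]
    simp [setCell, h6, h.idx_seven, h.numArr_zero, h.res_eq]
  · simp [setCell_of_ne, h.exc_eq]

theorem BudgetsEntered.halts_loop {S P : ℕ} {m₀ m : Memory} (h : BudgetsEntered S P m₀ 0 m) :
    Halts (.loop (idxLt 7 0) supervisorProgram) m fun t m' =>
      t ≤ 4 * S + 1 ∧ BudgetsEntered S P m₀ S m' := by
  refine (Halts.loop (fun k m' => ∃ i ≤ S, 4 * (S - i) + 1 ≤ k ∧
    BudgetsEntered S P m₀ i m') (k := 4 * S + 1) ⟨0, by omega, le_rfl, h⟩ ?_ ?_).mono ?_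
  · rintro k m₁ ⟨i, hi, hk, h1⟩ hb
    change m₁.idx 7 < m₁.idx 0 at hb
    rw [h1.idx_seven, h1.idx_zero] at hb
    exact (h1.halts_supervisorProgram hb).mono fun t m₂ ⟨ht, h2⟩ =>
      ⟨4 * (S - (i + 1)) + 1, ⟨i + 1, hb, le_rfl, h2⟩, by omega⟩
  · rintro k m₁ ⟨i, -, hk, -⟩ -
    omega
  · rintro t m₁ ⟨ht, hb, k, i, hi, -, h1⟩
    change ¬ m₁.idx 7 < m₁.idx 0 at hb
    rw [h1.idx_seven, h1.idx_zero] at hb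
    obtain rfl : i = S := by omega
    exact ⟨ht, h1⟩

/-- All index and number registers but the first two index registers, and all arrays but those
of the input, are zero. -/
structure Memory.Blank (m : Memory) : Prop where
  idx : ∀ x, 2 ≤ x → m.idx x = 0
  num : ∀ x, m.num x = 0
  idxArr : ∀ k, 1 ≤ k → ∀ i j, m.idxArr k i j = 0
  numArr : ∀ k, 2 ≤ k → ∀ i j, m.numArr k i j = 0

theorem halts_setupProgram {S P : ℕ} {m₀ : Memory} (hm : m₀.Blank) (hS : m₀.idx 0 = S)
    (hP : m₀.idx 1 = P) :
    Halts setupProgram m₀ fun t m =>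
      t ≤ (6 * S + 7) * P + 4 * S + 7 ∧ m.Ready (S + 1 + P) ∧
      m.pushState =
        { res := fundingRes S P (m₀.idxArr 0) (fun i => m₀.numArr 0 i 0)
            (fun j => m₀.numArr 1 j 0)
          exc := fundingExc S P (fun j => m₀.numArr 1 j 0)
          lab := fun _ => 0
          cur := fun _ => 0
          pos := 1, act := 0, run := 1, ans := 0 } := by
  simp only [setupProgram, block, halts_seq_iff, halts_instr_iff, Instr.apply]
  have h1 : ProjectsEntered S P m₀ 0
      { m₀ with idx := Function.update m₀.idx 2 (m₀.idx 0 + 1) } := by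
    constructor <;> simp only [Function.update_apply]
    · simp [hS]
    · simp [hP]
    · simp [hS]
    · intro x h3 h7
      rw [if_neg (by omega), hm.idx x (by omega)]
    · simp [hm.idx]
    · exact hm.num 0
    · intro u w
      simp [hm.numArr, fundingRes]
      omega
    · intro u
      have h2 : ¬ (S < u ∧ u ≤ S) := by omega
      simp [hm.numArr, fundingExc, h2]
  refine h1.halts_loop.mono fun t₁ m₁ ⟨ht₁, h2⟩ => ?_
  have h3 : BudgetsEntered S P m₀ 0 { m₁ with idx := Function.update m₁.idx 7 0 } := by
    constructor <;> simp only [Function.update_apply]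
    · simp [h2.idx_zero]
    · simp [h2.idx_two]
    · intro x h3 h7
      rw [if_neg (by omega), h2.idx_eq_zero x h3 h7]
    · simp
    · exact h2.num_zero
    · exact h2.idxArr_eq
    · exact h2.numArr_zero
    · simpa using h2.res_eq
    · exact h2.exc_eq
  refine h3.halts_loop.mono fun t₂ m₂ ⟨ht₂, h4⟩ => ?_
  have h5 := h4.idx_eq_zero
  refine ⟨by omega, ?_, ?_⟩
  · simp [Memory.Ready, h4.idx_two, h5, h4.num_zero]
  · simp only [Memory.pushState, PushState.mk.injEq]
    refine ⟨?_, ?_, ?_, ?_, ?_, ?_, ?_, ?_⟩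
    · funext u w
      rw [h4.res_eq]
      unfold fundingRes
      by_cases hu : 0 < u ∧ u ≤ S
      · have h6 : u - 1 < S := by omega
        simp [h6]
      · simp [hu]
    · funext u
      exact h4.exc_eq u
    all_goals simp [h4.idxArr_eq, hm.idxArr, h5]

/-! ### The running time -/

/-- The program that checks feasibility. -/
def feasibilityProgram : Program := .seq setupProgram mainLoop

theorem halts_feasibilityProgram {S P : ℕ} {m : Memory} (hm : m.Blank) (hS : m.idx 0 = S)
    (hP : m.idx 1 = P) (hbud : ∀ i, 0 ≤ m.numArr 0 i 0) (hdem : ∀ j, 0 ≤ m.numArr 1 j 0) :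
    Halts feasibilityProgram m fun t m' =>
      t ≤ 300 * (S + 1 + P) ^ 3 ∧
      (Fundable S P (m.idxArr 0) (fun i => m.numArr 0 i 0) (fun j => m.numArr 1 j 0) →
        m'.idx 0 = 1) ∧
      (¬ Fundable S P (m.idxArr 0) (fun i => m.numArr 0 i 0) (fun j => m.numArr 1 j 0) →
        m'.idx 0 = 0) := by
  rw [feasibilityProgram, halts_seq_iff]
  refine (halts_setupProgram hm hS hP).mono fun t₁ m₁ ⟨ht₁, hr, hs⟩ => ?_
  have hN : 0 < S + 1 + P := by omega
  have hinv : m₁.pushState.Inv (S + 1 + P)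
      (Fundable S P (m.idxArr 0) (fun i => m.numArr 0 i 0) (fun j => m.numArr 1 j 0)) 0 0 := by
    rw [hs]
    exact PushState.inv_of_init hN (fun u _ w _ => fundingRes_nonneg hbud hdem u w)
      (fun v _ => fundingExc_nonneg hdem v)
      (routable_iff_fundable (bud := fun i => m.numArr 0 i 0) (dem := fun j => m.numArr 1 j 0))
      (fun _ => rfl) (fun _ => rfl) rfl rfl rfl rfl
  refine (halts_mainLoop hr hinv).mono fun t₂ m₂ ⟨ht₂, h1, h2⟩ => ⟨?_, h1, h2⟩
  have h3 := PushState.potential_le (s := m₁.pushState) hN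
  have h4 : (6 * S + 7) * P + 4 * S + 7 ≤ 7 * (S + 1 + P) ^ 2 := by nlinarith
  have h5 : (S + 1 + P) ^ 2 ≤ (S + 1 + P) ^ 3 := Nat.pow_le_pow_right hN (by norm_num)
  have h6 : 1 ≤ (S + 1 + P) ^ 3 := Nat.one_le_pow _ _ hN
  have h7 : (S + 1 + P) * (S + 1 + P) * (S + 1 + P) = (S + 1 + P) ^ 3 := by ring
  omega

theorem SIP.blank_inputMemory {A P S : Type*} [DecidableEq P] [Fintype P] [Fintype S]
    (I : SIP A P S) (M : Finset (A × P))
    (eS : S ≃ Fin (Fintype.card S)) (eP : P ≃ Fin (Fintype.card P)) :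
    (I.inputMemory M eS eP).Blank where
  idx x hx := by
    have h0 : x ≠ 0 := by omega
    have h1 : x ≠ 1 := by omega
    simp [inputMemory, h0, h1]
  num _ := rfl
  idxArr k hk i j := by
    have h0 : k ≠ 0 := by omega
    simp [inputMemory, h0]
  numArr k hk i j := by
    have h0 : k ≠ 0 := by omega
    have h1 : k ≠ 1 := by omega
    simp [inputMemory, h0, h1]

theorem SIP.numArr_inputMemory_nonneg {A P S : Type*} [DecidableEq P] [Fintype P] [Fintype S]
    (I : SIP A P S) (M : Finset (A × P))
    (eS : S ≃ Fin (Fintype.card S)) (eP : P ≃ Fin (Fintype.card P)) (k i j : ℕ) :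
    0 ≤ (I.inputMemory M eS eP).numArr k i j := by
  unfold inputMemory
  dsimp only
  split_ifs
  · exact I.budget_nonneg _
  · exact Nat.cast_nonneg _
  · exact le_rfl

/-- With `n` supervisors and `n` projects at most, the network has at most `2 * n + 1` vertices. -/
theorem isBigO_cube (c : ℕ) :
    Asymptotics.IsBigO Filter.atTop (fun n : ℕ => ((c * (2 * n + 1) ^ 3 : ℕ) : ℝ))
      (fun n : ℕ => (n : ℝ) ^ 3) := by
  refine Asymptotics.IsBigO.of_bound (27 * c) ?_
  filter_upwards [Filter.eventually_ge_atTop 1] with n hn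
  have hn' : (1 : ℝ) ≤ n := by exact_mod_cast hn
  rw [Real.norm_of_nonneg (by positivity), Real.norm_of_nonneg (by positivity)]
  push_cast
  have h1 : (2 * (n : ℝ) + 1) ^ 3 ≤ (3 * n) ^ 3 :=
    pow_le_pow_left₀ (by positivity) (by linarith) 3
  calc (c : ℝ) * (2 * n + 1) ^ 3 ≤ c * (3 * n) ^ 3 := by gcongr
    _ = 27 * c * (n : ℝ) ^ 3 := by ring

theorem mainTheorem6 :
    (∀ (A P S : Type*) [Fintype A] [Fintype P] [Fintype S] [DecidableEq A] [DecidableEq P]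
        (I : SIP A P S) (M : Finset (A × P)), I.IsMatching M →
      (I.Feasible M ↔
        ∃ f : FundingVertex P S → FundingVertex P S → ℝ,
          (I.fundingNetwork M).IsFlow f ∧ (I.fundingNetwork M).value f = (M.card : ℝ))) ∧
    -- one program, with running time `O(max{|S|, |P|}^3)`, for all instances and matchings;
    -- it answers in index register 0
    (∃ (prog : Program) (T : ℕ → ℕ),
      Asymptotics.IsBigO Filter.atTop (fun n : ℕ => (T n : ℝ)) (fun n : ℕ => (n : ℝ) ^ 3) ∧
      ∀ (A P S : Type*) [Fintype A] [Fintype P] [Fintype S] [DecidableEq A] [DecidableEq P]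
        (I : SIP A P S) (M : Finset (A × P)), I.IsMatching M →
        ∀ (eS : S ≃ Fin (Fintype.card S)) (eP : P ≃ Fin (Fintype.card P)),
          ∃ (t : ℕ) (m : Memory),
            Exec prog (I.inputMemory M eS eP) t m ∧
            t ≤ T (max (Fintype.card S) (Fintype.card P)) ∧
            (I.Feasible M → m.idx 0 = 1) ∧ (¬ I.Feasible M → m.idx 0 = 0)) := by
  refine ⟨fun A P S _ _ _ _ _ I M _ => I.feasible_iff_exists_isFlow M,
    feasibilityProgram, fun n => 300 * (2 * n + 1) ^ 3, isBigO_cube 300, ?_⟩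
  intro A P S _ _ _ _ _ I M _ eS eP
  obtain ⟨t, m, h1, h2, h3, h4⟩ := halts_feasibilityProgram (S := Fintype.card S)
    (P := Fintype.card P) (I.blank_inputMemory M eS eP) rfl rfl
    (fun i => I.numArr_inputMemory_nonneg M eS eP 0 i 0)
    (fun j => I.numArr_inputMemory_nonneg M eS eP 1 j 0)
  rw [I.fundable_iff_feasible M eS eP] at h3 h4
  refine ⟨t, m, h1, h2.trans ?_, h3, h4⟩
  have h5 := le_max_left (Fintype.card S) (Fintype.card P)
  have h6 := le_max_right (Fintype.card S) (Fintype.card P)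
  exact Nat.mul_le_mul_left 300 (Nat.pow_le_pow_left (by omega) 3)
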